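/- Let $k$ be a field. For subcoalgebras $A,B$ of a $k$-coalgebra $C$ write $A\wedge B=\ker\bigl(C\xrightarrow{\Delta}C\otimes C\to C/A\otimes C/B\bigr)$. A coalgebra $C$ is \emph{prime} if, for all subcoalgebras $A,B$ of $C$, $C=A\wedge B$ implies $C=A$ or $C=B$; it is \emph{semiprime} if, for every subcoalgebra $A$ of $C$, $C=A\wedge A$ implies $C=A$. It is \emph{hereditary} if every quotient of an injective right $C$-comodule is injective, or if every quotient of an injective left $C$-comodule is injective (it is well known that the two conditions are equivalent). The right (respectively left) valued Gabriel quiver of $C$ has as vertices the isomorphism classes of simple right (respectively left) $C$-comodules, with a unique (valued) arrow from $S$ to $T$ if $\operatorname{Ext}^1_C(S,T)\neq 0$ and no arrow from $S$ to $T$ otherwise; the values of the arrows play no role below. A quiver is \emph{strongly connected} if for any two vertices $x,y$ there is an oriented path, possibly of length $0$, from $x$ to $y$; its \emph{connected components} are those of the underlying unoriented graph, regarded as full subquivers. \textbf{Theorem.} (i) If $C$ is a semiprime coalgebra over $k$, then each connected component of the right, and of the left, valued Gabriel quiver of $C$ is strongly connected. (ii) If $C$ is a hereditary coalgebra over $k$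 whose right or left valued Gabriel quiver is strongly connected, then $C$ is prime. Consequently, every hereditary semiprime coalgebra over $k$ is isomorphic, as a coalgebra, to a direct sum of nonzero prime coalgebras. -/

import Mathlib

open scoped TensorProduct DirectSum

universe u v

noncomputable section

namespace CoalgebraPrime

/-! ### Subcoalgebras, wedge products, prime and semiprime coalgebras -/

section Wedge

variable (k : Type u) {C : Type v} [Field k] [AddCommGroup C] [Module k C] [Coalgebra k C]

/-- A subspace `A` is a subcoalgebra if `Δ(A) ⊆ A ⊗ A` (inside `C ⊗ C`). -/
def IsSubcoalgebra (A : Submodule k C) : Prop :=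
  ∀ x ∈ A, Coalgebra.comul (R := k) x ∈ LinearMap.range (TensorProduct.map A.subtype A.subtype)

/-- The wedge product `A ∧ B`, the kernel of `C → C ⊗ C → C/A ⊗ C/B`. -/
def wedge (A B : Submodule k C) : Submodule k C :=
  LinearMap.ker
    (TensorProduct.map A.mkQ B.mkQ ∘ₗ (Coalgebra.comul : C →ₗ[k] C ⊗[k] C))

variable (C)

/-- `C` is prime if `C = A ∧ B` with `A`, `B` subcoalgebras only when `A = C` or `B = C`. -/
def IsPrime : Prop :=
  ∀ A B : Submodule k C, IsSubcoalgebra k A → IsSubcoalgebra k B →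
    wedge k A B = ⊤ → A = ⊤ ∨ B = ⊤

/-- `C` is semiprime if `C = A ∧ A` with `A` a subcoalgebra only when `A = C`. -/
def IsSemiprime : Prop :=
  ∀ A : Submodule k C, IsSubcoalgebra k A → wedge k A A = ⊤ → A = ⊤

open Classical in
/-- `C` is isomorphic, as a coalgebra, to a direct sum of nonzero prime coalgebras. -/
def IsDirectSumOfPrimes : Prop :=
  ∃ (ι : Type v) (D : ι → Type v) (_ : ∀ i, AddCommGroup (D i)) (_ : ∀ i, Module k (D i))
    (_ : ∀ i, Coalgebra k (D i)),
    (∀ i, Nontrivial (D i) ∧ IsPrime k (D i)) ∧ Nonempty (C ≃ₗc[k] (Π₀ i, D i))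

end Wedge

/-! ### Right comodules -/

/-- A right comodule over the `k`-coalgebra `C`. -/
structure Comod (k : Type u) (C : Type v) [Field k] [AddCommGroup C] [Module k C]
    [Coalgebra k C] where
  carrier : Type v
  [addCommGroup : AddCommGroup carrier]
  [module : Module k carrier]
  /-- the coaction `ρ` -/
  coact : carrier →ₗ[k] carrier ⊗[k] C
  /-- `(ρ ⊗ id) ρ = (id ⊗ Δ) ρ` -/
  coassoc : (TensorProduct.assoc k carrier C C).toLinearMap ∘ₗ coact.rTensor C ∘ₗ coact =
    (Coalgebra.comul : C →ₗ[k] C ⊗[k] C).lTensor carrier ∘ₗ coact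
  /-- `(id ⊗ ε) ρ = id` -/
  counit : (TensorProduct.rid k carrier).toLinearMap ∘ₗ
    (Coalgebra.counit : C →ₗ[k] k).lTensor carrier ∘ₗ coact = LinearMap.id

attribute [instance] Comod.addCommGroup Comod.module

section Comodules

variable {k : Type u} {C : Type v} [Field k] [AddCommGroup C] [Module k C] [Coalgebra k C]

namespace Comod

/-- `f` is a homomorphism of right comodules. -/
def IsHom {M N : Comod k C} (f : M.carrier →ₗ[k] N.carrier) : Prop :=
  N.coact ∘ₗ f = f.rTensor C ∘ₗ M.coact

lemma IsHom.symm {M N : Comod k C} {e : M.carrier ≃ₗ[k] N.carrier}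
    (h : IsHom (M := M) (N := N) e.toLinearMap) :
    IsHom (M := N) (N := M) e.symm.toLinearMap := by
  unfold IsHom at *
  ext y
  obtain ⟨x, rfl⟩ := e.surjective y
  have h1 : N.coact (e x) = (e.toLinearMap.rTensor C) (M.coact x) := LinearMap.congr_fun h x
  simp only [LinearMap.comp_apply, LinearEquiv.coe_coe, LinearEquiv.symm_apply_apply, h1]
  rw [← LinearMap.comp_apply, ← LinearMap.rTensor_comp]
  simp

lemma IsHom.comp {M N P : Comod k C} {g : N.carrier →ₗ[k] P.carrier}
    {f : M.carrier →ₗ[k] N.carrier} (hg : IsHom (M := N) (N := P) g)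
    (hf : IsHom (M := M) (N := N) f) : IsHom (M := M) (N := P) (g ∘ₗ f) := by
  unfold IsHom at *
  rw [← LinearMap.comp_assoc, hg, LinearMap.comp_assoc, hf, ← LinearMap.comp_assoc,
    ← LinearMap.rTensor_comp]

lemma isHom_id (M : Comod k C) :
    IsHom (M := M) (N := M) (LinearMap.id : M.carrier →ₗ[k] M.carrier) := by
  simp [IsHom]

/-- Isomorphism of right comodules. -/
def Iso (M N : Comod k C) : Prop :=
  ∃ e : M.carrier ≃ₗ[k] N.carrier, IsHom (M := M) (N := N) e.toLinearMap

/-- `N ⊆ M` is a subcomodule if `ρ(N) ⊆ N ⊗ C` (inside `M ⊗ C`). -/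
def IsSubcomodule (M : Comod k C) (N : Submodule k M.carrier) : Prop :=
  ∀ x ∈ N, M.coact x ∈ LinearMap.range (N.subtype.rTensor C)

/-- Simple comodules: nonzero, with no proper nonzero subcomodule. -/
def IsSimple (M : Comod k C) : Prop :=
  Nontrivial M.carrier ∧ ∀ N : Submodule k M.carrier, M.IsSubcomodule N → N = ⊥ ∨ N = ⊤

/-- Injective comodules: homomorphisms into `E` extend along injective homomorphisms. -/
def IsInjective (E : Comod k C) : Prop :=
  ∀ (M N : Comod k C) (i : M.carrier →ₗ[k] N.carrier) (f : M.carrier →ₗ[k] E.carrier),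
    IsHom (M := M) (N := N) i → Function.Injective i → IsHom (M := M) (N := E) f →
    ∃ g : N.carrier →ₗ[k] E.carrier, IsHom (M := N) (N := E) g ∧ g ∘ₗ i = f

/-- `Ext¹(S, T) ≠ 0`, with Yoneda's `Ext¹`: some short exact sequence of right comodules
`0 → T → M → S → 0` does not split. -/
def Ext1NeZero (S T : Comod k C) : Prop :=
  ∃ (M : Comod k C) (i : T.carrier →ₗ[k] M.carrier) (p : M.carrier →ₗ[k] S.carrier),
    IsHom (M := T) (N := M) i ∧ IsHom (M := M) (N := S) p ∧
    Function.Injective i ∧ Function.Exact i p ∧ Function.Surjective p ∧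
    ¬ ∃ s : S.carrier →ₗ[k] M.carrier, IsHom (M := S) (N := M) s ∧ p ∘ₗ s = LinearMap.id

end Comod

variable (k C)

/-- Right hereditary coalgebras: every quotient of an injective right comodule is injective. -/
def IsRightHereditary : Prop :=
  ∀ (E F : Comod k C) (q : E.carrier →ₗ[k] F.carrier),
    E.IsInjective → Comod.IsHom (M := E) (N := F) q → Function.Surjective q → F.IsInjective

/-- Simple right comodules up to isomorphism. -/
instance simpleSetoid : Setoid {S : Comod k C // S.IsSimple} where
  r S T := Comod.Iso S.1 T.1
  iseqv :=
    { refl := fun S => ⟨LinearEquiv.refl k _, Comod.isHom_id S.1⟩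
      symm := fun ⟨e, he⟩ => ⟨e.symm, he.symm⟩
      trans := fun ⟨e, he⟩ ⟨f, hf⟩ => ⟨e.trans f, hf.comp he⟩ }

/-- The vertices of the right Gabriel quiver: isomorphism classes of simple right comodules. -/
def RightGabriel : Type (max u (v + 1)) :=
  Quotient (simpleSetoid k C)

/-- The (quiver underlying the) right valued Gabriel quiver: there is a unique arrow from the class
of `S` to the class of `T` if `Ext¹(S, T) ≠ 0`, and none otherwise. -/
instance : Quiver (RightGabriel k C) where
  Hom X Y := PLift (∃ S T : {S : Comod k C // S.IsSimple},
    Quotient.mk (simpleSetoid k C) S = X ∧ Quotient.mk (simpleSetoid k C) T = Y ∧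
      Comod.Ext1NeZero S.1 T.1)

end Comodules

/-! ### Left comodules, as right comodules over the co-opposite coalgebra -/

/-- The co-opposite coalgebra: the same space and counit, with the flipped comultiplication. A left
`C`-comodule `M → C ⊗ M` is, after a flip of the tensor factors, the same as a right comodule
over `Cop C`. -/
def Cop (C : Type v) : Type v := C

section Cop

instance {C : Type v} [h : AddCommGroup C] : AddCommGroup (Cop C) := h

instance {k : Type u} {C : Type v} [Field k] [AddCommGroup C] [h : Module k C] :
    Module k (Cop C) := h

variable (k : Type u) (C : Type v) [Field k] [AddCommGroup C] [Module k C] [Coalgebra k C]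

/-- The flipped comultiplication `x ↦ ∑ x₂ ⊗ x₁`. -/
def flipComul : C →ₗ[k] C ⊗[k] C :=
  (TensorProduct.comm k C C).toLinearMap ∘ₗ (Coalgebra.comul : C →ₗ[k] C ⊗[k] C)

/-- `a ⊗ (b ⊗ c) ↦ c ⊗ (b ⊗ a)`. -/
def rev : C ⊗[k] (C ⊗[k] C) →ₗ[k] C ⊗[k] (C ⊗[k] C) :=
  (TensorProduct.assoc k C C C).toLinearMap ∘ₗ
    (TensorProduct.comm k C C).toLinearMap.rTensor C ∘ₗ
    (TensorProduct.comm k C (C ⊗[k] C)).toLinearMap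

lemma flipComul_coassoc :
    (TensorProduct.assoc k C C C).toLinearMap ∘ₗ (flipComul k C).rTensor C ∘ₗ flipComul k C =
      (flipComul k C).lTensor C ∘ₗ flipComul k C := by
  have h1 : (TensorProduct.assoc k C C C).toLinearMap ∘ₗ (flipComul k C).rTensor C ∘ₗ
      (TensorProduct.comm k C C).toLinearMap =
      rev k C ∘ₗ (Coalgebra.comul : C →ₗ[k] C ⊗[k] C).lTensor C := by
    ext a b
    simp [rev, flipComul]
  have h2 : (flipComul k C).lTensor C ∘ₗ (TensorProduct.comm k C C).toLinearMap =
      rev k C ∘ₗ (TensorProduct.assoc k C C C).toLinearMap ∘ₗ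
        (Coalgebra.comul : C →ₗ[k] C ⊗[k] C).rTensor C := by
    have h3 : (TensorProduct.comm k C C).toLinearMap.lTensor C ∘ₗ
        (TensorProduct.comm k (C ⊗[k] C) C).toLinearMap =
        rev k C ∘ₗ (TensorProduct.assoc k C C C).toLinearMap := by
      ext a b c
      simp [rev]
    rw [← LinearMap.comp_assoc, ← h3]
    ext a b
    simp [flipComul]
  calc
    _ = ((TensorProduct.assoc k C C C).toLinearMap ∘ₗ (flipComul k C).rTensor C ∘ₗ
      (TensorProduct.comm k C C).toLinearMap) ∘ₗ (Coalgebra.comul : C →ₗ[k] C ⊗[k] C) := rfl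
    _ = ((flipComul k C).lTensor C ∘ₗ (TensorProduct.comm k C C).toLinearMap) ∘ₗ
      (Coalgebra.comul : C →ₗ[k] C ⊗[k] C) := by
        rw [h1, h2, LinearMap.comp_assoc, LinearMap.comp_assoc, LinearMap.comp_assoc,
          Coalgebra.coassoc]
    _ = _ := rfl

lemma flipComul_rTensor_counit :
    (Coalgebra.counit : C →ₗ[k] k).rTensor C ∘ₗ flipComul k C = TensorProduct.mk k k C 1 := by
  have h : (Coalgebra.counit : C →ₗ[k] k).rTensor C ∘ₗ (TensorProduct.comm k C C).toLinearMap =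
      (TensorProduct.comm k C k).toLinearMap ∘ₗ
        (Coalgebra.counit : C →ₗ[k] k).lTensor C := by
    ext a b
    simp
  rw [flipComul, ← LinearMap.comp_assoc, h, LinearMap.comp_assoc,
    Coalgebra.lTensor_counit_comp_comul]
  ext a
  simp

lemma flipComul_lTensor_counit :
    (Coalgebra.counit : C →ₗ[k] k).lTensor C ∘ₗ flipComul k C =
      (TensorProduct.mk k C k).flip 1 := by
  have h : (Coalgebra.counit : C →ₗ[k] k).lTensor C ∘ₗ (TensorProduct.comm k C C).toLinearMap =
      (TensorProduct.comm k k C).toLinearMap ∘ₗ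
        (Coalgebra.counit : C →ₗ[k] k).rTensor C := by
    ext a b
    simp
  rw [flipComul, ← LinearMap.comp_assoc, h, LinearMap.comp_assoc,
    Coalgebra.rTensor_counit_comp_comul]
  ext a
  simp

instance : Coalgebra k (Cop C) where
  comul := flipComul k C
  counit := (Coalgebra.counit : C →ₗ[k] k)
  coassoc := flipComul_coassoc k C
  rTensor_counit_comp_comul := flipComul_rTensor_counit k C
  lTensor_counit_comp_comul := flipComul_lTensor_counit k C

/-- Left hereditary coalgebras: every quotient of an injective left comodule is injective. -/
def IsLeftHereditary : Prop :=
  IsRightHereditary k (Cop C)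

/-- The left Gabriel quiver: isomorphism classes of simple left comodules, with an arrow from the
class of `S` to the class of `T` if `Ext¹(S, T) ≠ 0` for left comodules. -/
abbrev LeftGabriel : Type (max u (v + 1)) :=
  RightGabriel k (Cop C)

end Cop

/-! ### Connected components of a quiver -/

/-- The vertices of a connected component of a quiver (connectedness ignores the direction of
arrows). -/
def Component {V : Type*} [Quiver V] (c : Quiver.WeaklyConnectedComponent V) : Type _ :=
  {x : V // Quiver.WeaklyConnectedComponent.mk x = c}

/-- A connected component, as a full subquiver. -/
instance {V : Type*} [Quiver V] (c : Quiver.WeaklyConnectedComponent V) :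
    Quiver (Component c) where
  Hom x y := x.1 ⟶ y.1

end CoalgebraPrime

end

/-! Right `C`-comodules are the rational modules over the dual algebra `C*`, and subspaces of `C`
are read through their annihilators in `C*`. A subcoalgebra `A` gives a two-sided ideal `ann A`, and
`C = A ∧ B` says that `ann B` carries `C` into `A`, so `ann A * ann B = 0`.

Let `X` be a set of vertices that no arrow leaves. A module with no simple submodule in `X` has no
simple subquotient in `X`: in a minimal counterexample, a simple in `X` sits directly above a simple
outside `X`, and that extension splits. Hence all simple subquotients of `V / torsion V X` lie
outside `X`. For `V = C` this gives `C = coalgPart X ∧ coalgPart Xᶜ`, and these two subcoalgebras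
meet in `0` (`wedge_coalgPart`, `coalgPart_inf`).

(i) If `C` is semiprime, `D = coalgPart X + coalgPart Xᶜ` satisfies `D ∧ D = C`, so `D = C`. A
direct sum is symmetric, so the wedge in the other order is also `C`, and then no arrow enters `X`
either (`isEmpty_hom_of_wedge`). Taking for `X` the vertices reachable from `y`, every arrow into
`y` is reversed by a path out of `y`.

(ii) Let `C = A ∧ B` with `A ≠ C`. By heredity `C / A` is injective; it is nonzero and killed by
`ann B`. Consider the simples that embed in an injective comodule killed by `ann B`. If `S → T` is
an arrow and `T` embeds in such an `I`, the nonsplit extension embeds in `I`, so `S` embeds in the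
injective `I / T`; the set is therefore closed under predecessors (`mem_injOver_of_hom`). By strong
connectedness it contains every simple. Every finite-dimensional comodule then embeds in a finite
product of such injectives, so `ann B` kills all of `C` and `B = C`.

The left and right quivers are linked by a symmetric criterion: strong connectedness fails exactly
when `C` is the wedge of two nonzero subcoalgebras with zero intersection. For the decomposition,
the argument of (ii) is run inside `C` for one connected component at a time (`coalgPart_prime`),
and (i) makes `C` the direct sum of the resulting pieces. -/

noncomputable section

namespace CoalgebraPrime

/-! ### The dual algebra and rational modules -/

section Slice

variable {k : Type*} {C : Type*} [Field k] [AddCommGroup C] [Module k C]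
variable {V : Type*} [AddCommGroup V] [Module k V] {W : Type*} [AddCommGroup W] [Module k W]

/-- `id ⊗ f : V ⊗ C → V`. -/
def slice (V : Type*) [AddCommGroup V] [Module k V] (f : C →ₗ[k] k) : V ⊗[k] C →ₗ[k] V :=
  (TensorProduct.rid k V).toLinearMap ∘ₗ f.lTensor V

@[simp]
lemma slice_tmul (f : C →ₗ[k] k) (x : V) (c : C) : slice V f (x ⊗ₜ c) = f c • x := by
  simp [slice]

lemma slice_add (f g : C →ₗ[k] k) (t : V ⊗[k] C) :
    slice V (f + g) t = slice V f t + slice V g t := by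
  simp [slice, LinearMap.lTensor_add]

lemma slice_smul (a : k) (f : C →ₗ[k] k) (t : V ⊗[k] C) :
    slice V (a • f) t = a • slice V f t := by
  simp [slice, LinearMap.lTensor_smul]

lemma slice_rTensor (f : C →ₗ[k] k) (h : V →ₗ[k] W) (t : V ⊗[k] C) :
    slice W f (h.rTensor C t) = h (slice V f t) := by
  induction t with
  | zero => simp
  | add x y hx hy => simp [hx, hy]
  | tmul x c => simp

/-- Slicing with the coordinate functionals of a basis of `C` gives the coordinates of the tensor.
Because slices separate tensors, a coaction is determined by the action of the dual algebra. -/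
lemma eq_zero_of_slice {t : V ⊗[k] C} (h : ∀ f : C →ₗ[k] k, slice V f t = 0) : t = 0 := by
  classical
  let b := Module.Basis.ofVectorSpace k C
  apply (TensorProduct.equivFinsuppOfBasisRight (M := V) b).injective
  ext i
  rw [TensorProduct.equivFinsuppOfBasisRight_apply]
  simpa [slice] using h (b.coord i)

lemma eq_of_slice {s t : V ⊗[k] C} (h : ∀ f : C →ₗ[k] k, slice V f s = slice V f t) : s = t :=
  sub_eq_zero.1 <| eq_zero_of_slice fun f => by rw [map_sub, h, sub_self]

lemma mem_range_of_slice {N : Submodule k V} {t : V ⊗[k] C}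
    (h : ∀ f : C →ₗ[k] k, slice V f t ∈ N) : t ∈ LinearMap.range (N.subtype.rTensor C) := by
  have ex := rTensor_exact C (LinearMap.exact_subtype_mkQ N) N.mkQ_surjective
  apply (ex t).1
  apply eq_zero_of_slice
  intro f
  rw [slice_rTensor]
  simpa using h f

lemma slice_mem {N : Submodule k V} {t : V ⊗[k] C}
    (h : t ∈ LinearMap.range (N.subtype.rTensor C)) (f : C →ₗ[k] k) : slice V f t ∈ N := by
  obtain ⟨s, rfl⟩ := h
  rw [slice_rTensor]
  exact Subtype.coe_prop _

/-- The left legs of a finite sum of pure tensors span such an `N`; this is the source of local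
finiteness. -/
lemma exists_fg_slice (t : V ⊗[k] C) :
    ∃ N : Submodule k V, N.FG ∧ ∀ f : C →ₗ[k] k, slice V f t ∈ N := by
  induction t with
  | zero => exact ⟨⊥, Submodule.fg_bot, by simp⟩
  | add x y hx hy =>
    obtain ⟨N, hN, h⟩ := hx
    obtain ⟨N', hN', h'⟩ := hy
    exact ⟨N ⊔ N', hN.sup hN', fun f => by
      rw [map_add]; exact Submodule.add_mem_sup (h f) (h' f)⟩
  | tmul x c =>
    exact ⟨k ∙ x, Submodule.fg_span_singleton x, fun f => by
      rw [slice_tmul]; exact Submodule.smul_mem _ _ (Submodule.mem_span_singleton_self x)⟩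

end Slice

/-- The dual algebra of a coalgebra, with the convolution product. -/
def DualAlg (k : Type u) (C : Type v) [Field k] [AddCommGroup C] [Module k C] [Coalgebra k C] :
    Type (max u v) :=
  WithConv (C →ₗ[k] k)

namespace DualAlg

variable {k : Type u} {C : Type v} [Field k] [AddCommGroup C] [Module k C] [Coalgebra k C]

instance : Ring (DualAlg k C) := inferInstanceAs (Ring (WithConv (C →ₗ[k] k)))

instance : Algebra k (DualAlg k C) := inferInstanceAs (Algebra k (WithConv (C →ₗ[k] k)))

/-- The underlying functional of an element of the dual algebra. -/
def fn (f : DualAlg k C) : C →ₗ[k] k := WithConv.ofConv f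

/-- A functional, as an element of the dual algebra. -/
def of (f : C →ₗ[k] k) : DualAlg k C := WithConv.toConv f

end DualAlg

section Rational

variable {k : Type u} {C : Type v} [Field k] [AddCommGroup C] [Module k C] [Coalgebra k C]

lemma DualAlg.mul_apply (f g : DualAlg k C) (c : C) :
    (f * g).fn c = f.fn (slice C g.fn (Coalgebra.comul c)) := by
  change LinearMap.mul' k k (TensorProduct.map f.fn g.fn (Coalgebra.comul c)) = _
  generalize (Coalgebra.comul c : C ⊗[k] C) = t
  induction t with
  | zero => simp
  | add x y hx hy => simp only [map_add, hx, hy]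
  | tmul x y => simp [mul_comm]

/-- Coassociativity turns into associativity of the action. Leaving `s` free allows both an iterated
coaction and a tensor obtained by inverting the associator. -/
lemma slice_slice (V : Type*) [AddCommGroup V] [Module k V] (f g : DualAlg k C)
    (t : V ⊗[k] C) (s : (V ⊗[k] C) ⊗[k] C)
    (h : (TensorProduct.assoc k V C C) s = (Coalgebra.comul : C →ₗ[k] C ⊗[k] C).lTensor V t) :
    slice V f.fn (slice (V ⊗[k] C) g.fn s) = slice V (f * g).fn t := by
  have h1 : ∀ s : (V ⊗[k] C) ⊗[k] C, slice V f.fn (slice (V ⊗[k] C) g.fn s) =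
      (TensorProduct.rid k V) ((LinearMap.lTensor V (LinearMap.mul' k k ∘ₗ
        TensorProduct.map f.fn g.fn)) (TensorProduct.assoc k V C C s)) := by
    intro s
    induction s with
    | zero => simp
    | add x y hx hy => rw [map_add, map_add, hx, hy]; simp only [map_add]
    | tmul y c =>
      induction y with
      | zero => simp
      | add x y hx hy =>
        simp only [TensorProduct.add_tmul, map_add] at hx hy ⊢
        rw [hx, hy]
      | tmul x d => simp [smul_smul, mul_comm]
  rw [h1, h, ← LinearMap.comp_apply, ← LinearMap.lTensor_comp]
  rfl

/-- A right comodule is a left module over the dual algebra. -/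
instance Comod.instModuleDualAlg (M : Comod k C) : Module (DualAlg k C) M.carrier where
  smul f x := slice M.carrier f.fn (M.coact x)
  one_smul x := LinearMap.congr_fun M.counit x
  mul_smul f g x := by
    change slice _ _ _ = slice _ _ (M.coact (slice _ _ _))
    rw [← slice_rTensor]
    refine (slice_slice _ f g _ _ ?_).symm
    exact LinearMap.congr_fun M.coassoc x
  smul_zero f := by change slice _ _ _ = _; simp
  smul_add f x y := by change slice _ _ _ = slice _ _ _ + slice _ _ _; simp
  add_smul f g x := slice_add _ _ _
  zero_smul x := by
    have h : DualAlg.fn (0 : DualAlg k C) = 0 := rfl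
    change slice _ _ _ = _
    rw [h]
    simp [slice]

lemma Comod.smul_def (M : Comod k C) (f : DualAlg k C) (x : M.carrier) :
    f • x = slice M.carrier f.fn (M.coact x) := rfl

instance (M : Comod k C) : IsScalarTower k (DualAlg k C) M.carrier where
  smul_assoc _ _ _ := slice_smul _ _ _

/-- A module over the dual algebra is rational if it comes from a comodule. -/
class IsRational (k : Type u) (C : Type v) [Field k] [AddCommGroup C] [Module k C] [Coalgebra k C]
    (V : Type v) [AddCommGroup V] [Module k V] [Module (DualAlg k C) V]
    [IsScalarTower k (DualAlg k C) V] : Prop where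
  exists_tensor : ∀ x : V, ∃ t : V ⊗[k] C, ∀ f : DualAlg k C, slice V f.fn t = f • x

instance (M : Comod k C) : IsRational k C M.carrier where
  exists_tensor x := ⟨M.coact x, fun _ => rfl⟩

section RationalModule

variable {V : Type v} [AddCommGroup V] [Module k V] [Module (DualAlg k C) V]
  [IsScalarTower k (DualAlg k C) V]
  {W : Type v} [AddCommGroup W] [Module k W] [Module (DualAlg k C) W]
  [IsScalarTower k (DualAlg k C) W]

lemma IsRational.of_surjective [IsRational k C V] (p : V →ₗ[DualAlg k C] W)
    (hp : Function.Surjective p) : IsRational k C W where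
  exists_tensor y := by
    obtain ⟨x, rfl⟩ := hp y
    obtain ⟨t, ht⟩ := IsRational.exists_tensor (k := k) (C := C) x
    refine ⟨(p.restrictScalars k).rTensor C t, fun f => ?_⟩
    rw [slice_rTensor, ht]
    simp

lemma IsRational.of_injective [IsRational k C W] (i : V →ₗ[DualAlg k C] W)
    (hi : Function.Injective i) : IsRational k C V where
  exists_tensor x := by
    obtain ⟨t, ht⟩ := IsRational.exists_tensor (k := k) (C := C) (i x)
    have h1 : t ∈ LinearMap.range ((i.restrictScalars k).rTensor C) := by
      have h2 : t ∈ LinearMap.range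
          ((LinearMap.range (i.restrictScalars k)).subtype.rTensor C) := by
        apply mem_range_of_slice
        intro f
        have hf := ht (DualAlg.of f)
        rw [← map_smul] at hf
        refine (congrArg (· ∈ _) hf).mpr ?_
        exact LinearMap.mem_range_self (i.restrictScalars k) _
      obtain ⟨s, rfl⟩ := h2
      let e := LinearEquiv.ofInjective (i.restrictScalars k) hi
      refine ⟨e.symm.toLinearMap.rTensor C s, ?_⟩
      rw [← LinearMap.comp_apply, ← LinearMap.rTensor_comp]
      congr 2
      ext y
      obtain ⟨z, rfl⟩ := e.surjective y
      simp only [LinearMap.comp_apply, LinearEquiv.coe_coe, LinearEquiv.symm_apply_apply]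
      rfl
    obtain ⟨s, rfl⟩ := h1
    refine ⟨s, fun f => hi ?_⟩
    have := ht f
    rw [slice_rTensor] at this
    rw [map_smul, ← this]
    rfl

instance [IsRational k C V] (N : Submodule (DualAlg k C) V) : IsRational k C N :=
  IsRational.of_injective N.subtype N.subtype_injective

instance [IsRational k C V] (N : Submodule (DualAlg k C) V) : IsRational k C (V ⧸ N) :=
  IsRational.of_surjective N.mkQ N.mkQ_surjective

instance [IsRational k C V] [IsRational k C W] : IsRational k C (V × W) where
  exists_tensor x := by
    obtain ⟨s, hs⟩ := IsRational.exists_tensor (k := k) (C := C) x.1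
    obtain ⟨t, ht⟩ := IsRational.exists_tensor (k := k) (C := C) x.2
    refine ⟨(LinearMap.inl k V W).rTensor C s + (LinearMap.inr k V W).rTensor C t, fun f => ?_⟩
    rw [map_add, slice_rTensor, slice_rTensor, hs, ht]
    ext <;> simp

instance : IsRational k C PUnit.{v + 1} where
  exists_tensor _ := ⟨0, fun _ => rfl⟩

variable (k C V) in
/-- The coaction of a rational module. -/
def ratCoact [IsRational k C V] : V →ₗ[k] V ⊗[k] C where
  toFun x := (IsRational.exists_tensor (k := k) (C := C) x).choose
  -- The chosen tensor is unique, since slices separate tensors, so the choice is automatically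
  -- linear.
  map_add' x y := by
    apply eq_of_slice
    intro f
    have h (z : V) := (IsRational.exists_tensor (k := k) (C := C) z).choose_spec
      (DualAlg.of f)
    rw [map_add]
    exact (h _).trans ((smul_add _ _ _).trans (congrArg₂ _ (h x) (h y)).symm)
  map_smul' a x := by
    apply eq_of_slice
    intro f
    have h (z : V) := (IsRational.exists_tensor (k := k) (C := C) z).choose_spec
      (DualAlg.of f)
    rw [map_smul]
    exact (h _).trans ((smul_comm _ _ _).trans (congrArg (a • ·) (h x)).symm)

lemma slice_ratCoact [IsRational k C V] (f : DualAlg k C) (x : V) :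
    slice V f.fn (ratCoact k C V x) = f • x :=
  (IsRational.exists_tensor (k := k) (C := C) x).choose_spec f

variable (k C V) in
/-- The comodule given by a rational module. -/
def ofRational [IsRational k C V] : Comod k C where
  carrier := V
  coact := ratCoact k C V
  coassoc := by
    ext x
    apply (TensorProduct.assoc k V C C).symm.injective
    simp only [LinearMap.comp_apply, LinearEquiv.coe_coe, LinearEquiv.symm_apply_apply]
    refine eq_of_slice fun g => eq_of_slice fun f => ?_
    have h1 := slice_slice V (DualAlg.of f) (DualAlg.of g) (ratCoact k C V x) _
      (LinearEquiv.apply_symm_apply _ _)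
    rw [slice_ratCoact, mul_smul, ← slice_ratCoact (DualAlg.of g) x,
      ← slice_ratCoact (DualAlg.of f)] at h1
    rw [slice_rTensor]
    exact h1.symm
  counit := by
    ext x
    exact (slice_ratCoact (1 : DualAlg k C) x).trans (one_smul _ x)

variable (k C V) in
/-- The identification of a rational module with the module of its comodule. -/
def ofRationalEquiv [IsRational k C V] : V ≃ₗ[DualAlg k C] (ofRational k C V).carrier where
  toFun x := x
  invFun x := x
  map_add' _ _ := rfl
  map_smul' f x := (slice_ratCoact f x).symm
  left_inv _ := rfl
  right_inv _ := rfl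

end RationalModule

/-! ### Comodule notions in terms of the dual algebra -/

namespace Comod

variable {M N : Comod k C}

lemma isHom_iff {f : M.carrier →ₗ[k] N.carrier} :
    IsHom (M := M) (N := N) f ↔ ∀ (r : DualAlg k C) (x : M.carrier), f (r • x) = r • f x := by
  constructor
  · intro h r x
    rw [smul_def, smul_def, ← slice_rTensor, ← LinearMap.comp_apply (N.coact), h]
    rfl
  · intro h
    ext x
    apply eq_of_slice
    intro r
    rw [LinearMap.comp_apply, LinearMap.comp_apply, slice_rTensor]
    exact (h (DualAlg.of r) x).symm

/-- A homomorphism of comodules as a map of modules over the dual algebra. -/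
def IsHom.toLinearMap {f : M.carrier →ₗ[k] N.carrier} (h : IsHom (M := M) (N := N) f) :
    M.carrier →ₗ[DualAlg k C] N.carrier :=
  { f with map_smul' := isHom_iff.1 h }

lemma isHom_restrictScalars (f : M.carrier →ₗ[DualAlg k C] N.carrier) :
    IsHom (M := M) (N := N) (f.restrictScalars k) :=
  isHom_iff.2 fun r x => map_smul f r x

lemma isSubcomodule_iff {P : Submodule k M.carrier} :
    M.IsSubcomodule P ↔ ∀ (r : DualAlg k C), ∀ x ∈ P, r • x ∈ P :=
  ⟨fun h r x hx => slice_mem (h x hx) r.fn,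
    fun h x hx => mem_range_of_slice fun f => h (DualAlg.of f) x hx⟩

lemma isSimple_iff : M.IsSimple ↔ IsSimpleModule (DualAlg k C) M.carrier := by
  rw [isSimpleModule_iff]
  constructor
  · rintro ⟨h1, h2⟩
    have : Nontrivial (Submodule (DualAlg k C) M.carrier) :=
      (Submodule.nontrivial_iff _).2 h1
    refine ⟨fun P => ?_⟩
    rcases h2 (P.restrictScalars k) (isSubcomodule_iff.2 fun r x hx => P.smul_mem r hx) with h | h
    · left
      rw [eq_bot_iff]
      intro x hx
      have : x ∈ P.restrictScalars k := hx
      rw [h] at this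
      exact this
    · right
      rw [eq_top_iff]
      intro x _
      have : x ∈ P.restrictScalars k := by rw [h]; trivial
      exact this
  · intro h
    refine ⟨(Submodule.nontrivial_iff (DualAlg k C)).1 h.toNontrivial, fun P hP => ?_⟩
    let P' : Submodule (DualAlg k C) M.carrier :=
      { P with smul_mem' := fun r x hx => isSubcomodule_iff.1 hP r x hx }
    have hP' : ∀ x, x ∈ P ↔ x ∈ P' := fun _ => Iff.rfl
    rcases h.eq_bot_or_eq_top P' with h | h
    · left; ext x; rw [hP', h]; rfl
    · right; ext x; rw [hP', h]; simp

lemma iso_iff : Iso M N ↔ Nonempty (M.carrier ≃ₗ[DualAlg k C] N.carrier) := by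
  constructor
  · rintro ⟨e, he⟩
    exact ⟨{ e with map_smul' := isHom_iff.1 he }⟩
  · rintro ⟨e⟩
    exact ⟨e.restrictScalars k, isHom_restrictScalars e.toLinearMap⟩

end Comod

end Rational

/-! ### Local finiteness and simple submodules -/

section Finiteness

variable {k : Type u} {C : Type v} [Field k] [AddCommGroup C] [Module k C] [Coalgebra k C]
  {V : Type v} [AddCommGroup V] [Module k V] [Module (DualAlg k C) V]
  [IsScalarTower k (DualAlg k C) V]

variable (k C) in
lemma finite_span_singleton [IsRational k C V] (x : V) : Module.Finite k (DualAlg k C ∙ x) := by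
  obtain ⟨t, ht⟩ := IsRational.exists_tensor (k := k) (C := C) x
  obtain ⟨N, hN, h⟩ := exists_fg_slice t
  have : Module.Finite k N := Module.Finite.iff_fg.2 hN
  have hle : ∀ y ∈ (DualAlg k C ∙ x), y ∈ N := by
    intro y hy
    obtain ⟨f, rfl⟩ := Submodule.mem_span_singleton.1 hy
    rw [← ht f]
    exact h _
  exact Module.Finite.of_injective
    ((((DualAlg k C ∙ x).restrictScalars k).subtype).codRestrict N fun y => hle _ y.2)
    (fun a b hab => Subtype.ext (congrArg (fun z : N => (z : V)) hab))

lemma exists_simple_le_of_finite [Module.Finite k V] [Nontrivial V] :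
    ∃ T : Submodule (DualAlg k C) V, IsSimpleModule (DualAlg k C) T := by
  have : IsArtinian (DualAlg k C) V := isArtinian_of_tower k inferInstance
  obtain ⟨T, hT⟩ := IsAtomic.exists_atom (Submodule (DualAlg k C) V)
  exact ⟨T, isSimpleModule_iff_isAtom.2 hT⟩

lemma exists_isCoatom_of_finite [Module.Finite k V] [Nontrivial V] :
    ∃ T : Submodule (DualAlg k C) V, IsSimpleModule (DualAlg k C) (V ⧸ T) := by
  have : IsNoetherian (DualAlg k C) V := isNoetherian_of_tower k inferInstance
  obtain ⟨T, hT⟩ := IsCoatomic.exists_coatom (Submodule (DualAlg k C) V)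
  exact ⟨T, isSimpleModule_iff_isCoatom.2 hT⟩

variable (k C) in
/-- A nonzero rational module contains a simple submodule. -/
lemma exists_simple_le [IsRational k C V] [Nontrivial V] :
    ∃ T : Submodule (DualAlg k C) V, IsSimpleModule (DualAlg k C) T := by
  obtain ⟨x, hx⟩ := exists_ne (0 : V)
  have := finite_span_singleton k C x
  have : Nontrivial (DualAlg k C ∙ x) :=
    ⟨⟨x, Submodule.mem_span_singleton_self x⟩, 0, fun h => hx (congrArg Subtype.val h)⟩
  obtain ⟨T, hT⟩ := exists_simple_le_of_finite (k := k) (C := C) (V := (DualAlg k C ∙ x))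
  exact ⟨T.map (Submodule.subtype _), IsSimpleModule.congr
    (Submodule.equivMapOfInjective _ (Submodule.subtype_injective _) T).symm⟩

end Finiteness

/-! ### The regular comodule -/

section Regular

variable (k : Type u) (C : Type v) [Field k] [AddCommGroup C] [Module k C] [Coalgebra k C]

/-- The coalgebra as a right comodule over itself. -/
def regular : Comod k C where
  carrier := C
  coact := Coalgebra.comul
  coassoc := Coalgebra.coassoc
  counit := by
    rw [Coalgebra.lTensor_counit_comp_comul]
    ext; simp

/-- An element of `C`, as an element of the regular comodule. -/
def toRegular : C ≃ₗ[k] (regular k C).carrier := LinearEquiv.refl k C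

variable {k C}

/-- The value of a functional at an element of the regular comodule. -/
def ev (f : DualAlg k C) : (regular k C).carrier →ₗ[k] k := f.fn

lemma ev_smul (f g : DualAlg k C) (c : (regular k C).carrier) : ev f (g • c) = ev (f * g) c :=
  (DualAlg.mul_apply f g c).symm

lemma regular_ext {c d : (regular k C).carrier} (h : ∀ f : DualAlg k C, ev f c = ev f d) :
    c = d := by
  rw [← sub_eq_zero, ← Module.forall_dual_apply_eq_zero_iff k]
  intro f
  rw [map_sub, sub_eq_zero]
  exact h (DualAlg.of f)

lemma ev_one_smul (f : DualAlg k C) (c : (regular k C).carrier) : ev 1 (f • c) = ev f c := by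
  rw [ev_smul, one_mul]

variable {V : Type v} [AddCommGroup V] [Module k V] [Module (DualAlg k C) V]
  [IsScalarTower k (DualAlg k C) V] [IsRational k C V]

/-- `m ↦ ∑ φ(m₀) m₁`. -/
def coeffAux (φ : V →ₗ[k] k) : V →ₗ[k] (regular k C).carrier :=
  (TensorProduct.lid k C).toLinearMap ∘ₗ φ.rTensor C ∘ₗ ratCoact k C V

lemma ev_coeffAux (φ : V →ₗ[k] k) (f : DualAlg k C) (x : V) :
    ev f (coeffAux φ x) = φ (f • x) := by
  rw [← slice_ratCoact]
  change f.fn (TensorProduct.lid k C (φ.rTensor C (ratCoact k C V x))) = _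
  generalize ratCoact k C V x = t
  induction t with
  | zero => simp
  | add x y hx hy => simp only [map_add, hx, hy]
  | tmul x c =>
    simp [mul_comm]

/-- The homomorphism of comodules `m ↦ ∑ φ(m₀) m₁` from a comodule to the regular comodule. -/
def coeff (φ : V →ₗ[k] k) : V →ₗ[DualAlg k C] (regular k C).carrier :=
  { coeffAux φ with
    map_smul' := fun f x => by
      apply regular_ext
      intro g
      change ev g (coeffAux φ (f • x)) = ev g (f • coeffAux φ x)
      rw [ev_coeffAux, ev_smul, ev_coeffAux, mul_smul] }

lemma ev_coeff (φ : V →ₗ[k] k) (f : DualAlg k C) (x : V) :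
    ev f (coeff φ x) = φ (f • x) := ev_coeffAux φ f x

/-- Linear functionals separate the points of `V`, so the annihilator of `x` can be read off from
its matrix coefficients in `C`. -/
lemma smul_eq_zero_of_coeff {f : DualAlg k C} {x : V}
    (h : ∀ φ : V →ₗ[k] k, ev f (coeff φ x) = 0) : f • x = 0 :=
  (Module.forall_dual_apply_eq_zero_iff k _).1 fun φ => by rw [← ev_coeff]; exact h φ

end Regular

/-! ### Injective rational modules -/

section Injective

variable {k : Type u} {C : Type v} [Field k] [AddCommGroup C] [Module k C] [Coalgebra k C]
  {V : Type v} [AddCommGroup V] [Module k V] [Module (DualAlg k C) V]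
  [IsScalarTower k (DualAlg k C) V] [IsRational k C V]
  {W : Type v} [AddCommGroup W] [Module k W] [Module (DualAlg k C) W]
  [IsScalarTower k (DualAlg k C) W] [IsRational k C W]

variable (k C V) in
/-- Injectivity in the category of rational modules. -/
def RatInjective : Prop := (ofRational k C V).IsInjective

lemma RatInjective.extend (h : RatInjective k C V)
    {M : Type v} [AddCommGroup M] [Module k M] [Module (DualAlg k C) M]
    [IsScalarTower k (DualAlg k C) M] [IsRational k C M]
    {N : Type v} [AddCommGroup N] [Module k N] [Module (DualAlg k C) N]
    [IsScalarTower k (DualAlg k C) N] [IsRational k C N]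
    (i : M →ₗ[DualAlg k C] N) (hi : Function.Injective i) (f : M →ₗ[DualAlg k C] V) :
    ∃ g : N →ₗ[DualAlg k C] V, ∀ x, g (i x) = f x := by
  let eM := ofRationalEquiv k C M
  let eN := ofRationalEquiv k C N
  let eV := ofRationalEquiv k C V
  let i' := eN.toLinearMap ∘ₗ i ∘ₗ eM.symm.toLinearMap
  let f' := eV.toLinearMap ∘ₗ f ∘ₗ eM.symm.toLinearMap
  obtain ⟨g, hg, hgi⟩ := h (ofRational k C M) (ofRational k C N) (i'.restrictScalars k)
    (f'.restrictScalars k) (Comod.isHom_restrictScalars i')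
    (eN.injective.comp (hi.comp eM.symm.injective)) (Comod.isHom_restrictScalars f')
  refine ⟨eV.symm.toLinearMap ∘ₗ hg.toLinearMap ∘ₗ eN.toLinearMap, fun x => ?_⟩
  exact congrArg eV.symm (LinearMap.congr_fun hgi (eM x))

lemma RatInjective.of_extend
    (h : ∀ (M N : Comod k C) (i : M.carrier →ₗ[DualAlg k C] N.carrier)
      (f : M.carrier →ₗ[DualAlg k C] V), Function.Injective i →
      ∃ g : N.carrier →ₗ[DualAlg k C] V, ∀ x, g (i x) = f x) : RatInjective k C V := by
  intro M N i f hi hinj hf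
  let eV := ofRationalEquiv k C V
  obtain ⟨g, hg⟩ := h M N hi.toLinearMap (eV.symm.toLinearMap ∘ₗ hf.toLinearMap) hinj
  exact ⟨(eV.toLinearMap ∘ₗ g).restrictScalars k, Comod.isHom_restrictScalars _,
    LinearMap.ext fun x => congrArg eV (hg x)⟩

lemma RatInjective.prod (hV : RatInjective k C V) (hW : RatInjective k C W) :
    RatInjective k C (V × W) := by
  refine RatInjective.of_extend fun M N i f hi => ?_
  obtain ⟨g, hg⟩ := hV.extend i hi (LinearMap.fst _ _ _ ∘ₗ f)
  obtain ⟨g', hg'⟩ := hW.extend i hi (LinearMap.snd _ _ _ ∘ₗ f)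
  exact ⟨g.prod g', fun x => Prod.ext (hg x) (hg' x)⟩

lemma ratInjective_punit : RatInjective k C PUnit.{v + 1} :=
  RatInjective.of_extend fun _ _ _ _ _ => ⟨0, fun _ => rfl⟩

-- Comodule maps `M → C` correspond to linear functionals on `M`, by composing with the counit in
-- one direction and by `coeff` in the other. Extending comodule maps thus reduces to extending
-- functionals over a field.
variable (k C) in
lemma ratInjective_regular : RatInjective k C (regular k C).carrier := by
  refine RatInjective.of_extend fun M N i f hi => ?_
  obtain ⟨j, hj⟩ := LinearMap.exists_leftInverse_of_injective (i.restrictScalars k)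
    (LinearMap.ker_eq_bot.2 hi)
  refine ⟨coeff (ev 1 ∘ₗ f.restrictScalars k ∘ₗ j), fun x => regular_ext fun g => ?_⟩
  have hjx : j (i (g • x)) = g • x := LinearMap.congr_fun hj (g • x)
  rw [ev_coeff, ← map_smul]
  simp only [LinearMap.comp_apply, hjx]
  rw [LinearMap.restrictScalars_apply, map_smul, ev_one_smul]

lemma RatInjective.quotient (hered : IsRightHereditary k C) (hV : RatInjective k C V)
    (N : Submodule (DualAlg k C) V) : RatInjective k C (V ⧸ N) :=
  hered (ofRational k C V) (ofRational k C (V ⧸ N))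
    (((ofRationalEquiv k C (V ⧸ N)).toLinearMap ∘ₗ N.mkQ ∘ₗ
      (ofRationalEquiv k C V).symm.toLinearMap).restrictScalars k) hV
    (Comod.isHom_restrictScalars _)
    ((ofRationalEquiv k C (V ⧸ N)).surjective.comp (N.mkQ_surjective.comp
      (ofRationalEquiv k C V).symm.surjective))

end Injective

/-! ### Simple subquotients -/

section Factors

variable (k : Type u) (C : Type v) [Field k] [AddCommGroup C] [Module k C] [Coalgebra k C]

/-- The vertex of the Gabriel quiver given by a simple comodule. -/
def vertex (S : {S : Comod k C // S.IsSimple}) : RightGabriel k C :=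
  Quotient.mk (simpleSetoid k C) S

variable {k C}

instance (S : {S : Comod k C // S.IsSimple}) : IsSimpleModule (DualAlg k C) S.1.carrier :=
  Comod.isSimple_iff.1 S.2

lemma vertex_eq_iff {S T : {S : Comod k C // S.IsSimple}} :
    vertex k C S = vertex k C T ↔ Nonempty (S.1.carrier ≃ₗ[DualAlg k C] T.1.carrier) :=
  Quotient.eq.trans Comod.iso_iff

variable (V : Type v) [AddCommGroup V] [Module k V] [Module (DualAlg k C) V]
  [IsScalarTower k (DualAlg k C) V]

variable (k C)

/-- A simple rational module, as a simple comodule. -/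
def simpleOf [IsRational k C V] [h : IsSimpleModule (DualAlg k C) V] :
    {S : Comod k C // S.IsSimple} :=
  ⟨ofRational k C V, Comod.isSimple_iff.2 (IsSimpleModule.congr (ofRationalEquiv k C V).symm)⟩

end Factors

section Factors

variable (k : Type u) (C : Type v) [Field k] [AddCommGroup C] [Module k C] [Coalgebra k C]
  (V : Type v) [AddCommGroup V] [Module (DualAlg k C) V]

/-- The isomorphism classes of the simple subquotients of a module. -/
def factors : Set (RightGabriel k C) :=
  {x | ∃ S, vertex k C S = x ∧ ∃ (N : Submodule (DualAlg k C) V)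
    (f : N →ₗ[DualAlg k C] S.1.carrier), f ≠ 0}

end Factors

section Factors

variable {k : Type u} {C : Type v} [Field k] [AddCommGroup C] [Module k C] [Coalgebra k C]
variable {V : Type v} [AddCommGroup V] [Module (DualAlg k C) V]
  {W : Type v} [AddCommGroup W] [Module (DualAlg k C) W]
  {N : Type v} [AddCommGroup N] [Module (DualAlg k C) N]

lemma mem_factors_of_injective (S : {S : Comod k C // S.IsSimple}) (i : N →ₗ[DualAlg k C] V)
    (hi : Function.Injective i) {f : N →ₗ[DualAlg k C] S.1.carrier} (hf : f ≠ 0) :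
    vertex k C S ∈ factors k C V := by
  refine ⟨S, rfl, LinearMap.range i, f ∘ₗ (LinearEquiv.ofInjective i hi).symm.toLinearMap,
    fun h => hf ?_⟩
  ext x
  simpa using LinearMap.congr_fun h (LinearEquiv.ofInjective i hi x)

lemma factors_subset_of_injective (i : V →ₗ[DualAlg k C] W) (hi : Function.Injective i) :
    factors k C V ⊆ factors k C W := by
  rintro _ ⟨S, rfl, N, f, hf⟩
  exact mem_factors_of_injective S (i ∘ₗ N.subtype) (hi.comp N.subtype_injective) hf

lemma factors_subset_of_surjective (p : V →ₗ[DualAlg k C] W) (hp : Function.Surjective p) :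
    factors k C W ⊆ factors k C V := by
  rintro _ ⟨S, rfl, N, f, hf⟩
  refine ⟨S, rfl, N.comap p, f ∘ₗ p.submoduleComap N, fun h => hf ?_⟩
  ext y
  obtain ⟨x, rfl⟩ := p.submoduleComap_surjective_of_surjective N hp y
  exact LinearMap.congr_fun h x

/-- A nonzero map from `N ≤ V` to a simple module either is nonzero on `N ∩ ker p`, or factors
through the image of `N` in `W`. -/
lemma factors_subset_union (p : V →ₗ[DualAlg k C] W) :
    factors k C V ⊆ factors k C (LinearMap.ker p) ∪ factors k C W := by
  rintro _ ⟨S, rfl, N, f, hf⟩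
  let q := p ∘ₗ N.subtype
  by_cases h : f ∘ₗ (LinearMap.ker q).subtype = 0
  · right
    have hle : LinearMap.ker q ≤ LinearMap.ker f := fun x hx => LinearMap.congr_fun h ⟨x, hx⟩
    refine mem_factors_of_injective S ((LinearMap.range q).subtype ∘ₗ
      q.quotKerEquivRange.toLinearMap)
      ((LinearMap.range q).subtype_injective.comp q.quotKerEquivRange.injective)
      (f := (LinearMap.ker q).liftQ f hle) fun h0 => hf ?_
    ext x
    exact LinearMap.congr_fun h0 (Submodule.Quotient.mk x)
  · left
    refine mem_factors_of_injective S
      ((N.subtype ∘ₗ (LinearMap.ker q).subtype).codRestrict (LinearMap.ker p) fun x => x.2)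
      (fun x y hxy => ?_) h
    have h' := congrArg Subtype.val hxy
    exact Subtype.ext (Subtype.ext h')

lemma factors_eq_empty_of_subsingleton [Subsingleton V] : factors k C V = ∅ := by
  rw [Set.eq_empty_iff_forall_notMem]
  rintro _ ⟨S, rfl, N, f, hf⟩
  exact hf (LinearMap.ext fun x => by rw [Subsingleton.elim x 0, map_zero, map_zero])

lemma factors_congr (e : V ≃ₗ[DualAlg k C] W) : factors k C V = factors k C W :=
  (factors_subset_of_injective e.toLinearMap e.injective).antisymm
    (factors_subset_of_surjective e.toLinearMap e.surjective)

lemma factors_simple (S : {S : Comod k C // S.IsSimple}) :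
    factors k C S.1.carrier = {vertex k C S} := by
  ext x
  constructor
  · rintro ⟨T, rfl, N, f, hf⟩
    rcases eq_bot_or_eq_top N with rfl | rfl
    · exact absurd (LinearMap.ext fun x => by rw [Subsingleton.elim x 0, map_zero, map_zero]) hf
    · let g := f ∘ₗ (Submodule.topEquiv (R := DualAlg k C)).symm.toLinearMap
      have hg : g ≠ 0 := fun h => hf <| LinearMap.ext fun x => LinearMap.congr_fun h x
      exact vertex_eq_iff.2 ⟨(LinearEquiv.ofBijective g
        ((LinearMap.bijective_or_eq_zero g).resolve_right hg)).symm⟩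
  · rintro rfl
    refine mem_factors_of_injective S LinearMap.id Function.injective_id (f := LinearMap.id) ?_
    intro h
    have := S.2.1
    obtain ⟨x, hx⟩ := exists_ne (0 : S.1.carrier)
    exact hx (LinearMap.congr_fun h x)

/-- Reduces questions about subquotients to cyclic submodules, which are finite-dimensional when the
module is rational. -/
lemma exists_mem_factors_span {x : RightGabriel k C} (hx : x ∈ factors k C V) :
    ∃ y : V, x ∈ factors k C (DualAlg k C ∙ y) := by
  obtain ⟨S, rfl, N, f, hf⟩ := hx
  obtain ⟨y, hy⟩ : ∃ y, f y ≠ 0 := by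
    by_contra! h
    exact hf (LinearMap.ext h)
  refine ⟨y, ?_⟩
  have hle : (DualAlg k C ∙ (y : V)) ≤ N := by
    rw [Submodule.span_singleton_le_iff_mem]
    exact y.2
  refine mem_factors_of_injective S LinearMap.id Function.injective_id
    (f := f ∘ₗ Submodule.inclusion hle) fun h => hy ?_
  exact LinearMap.congr_fun h ⟨y, Submodule.mem_span_singleton_self _⟩

section

variable [Module k V] [IsScalarTower k (DualAlg k C) V] [IsRational k C V]

lemma factors_of_isSimple [IsSimpleModule (DualAlg k C) V] :
    factors k C V = {vertex k C (simpleOf k C V)} :=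
  (factors_congr (ofRationalEquiv k C V)).trans (factors_simple (simpleOf k C V))

variable (k C V) in
lemma factors_nonempty [Nontrivial V] : (factors k C V).Nonempty := by
  obtain ⟨T, hT⟩ := exists_simple_le k C (V := V)
  refine ⟨vertex k C (simpleOf k C T), factors_subset_of_injective T.subtype
    T.subtype_injective ?_⟩
  rw [factors_of_isSimple]
  rfl

/-- Extensions split between simple modules whose vertices are not joined by an arrow. -/
lemma exists_section_of_isEmpty_hom
    {T : Type v} [AddCommGroup T] [Module k T] [Module (DualAlg k C) T]
    [IsScalarTower k (DualAlg k C) T] [IsRational k C T] [IsSimpleModule (DualAlg k C) T]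
    {S : {S : Comod k C // S.IsSimple}}
    (h : IsEmpty (vertex k C S ⟶ vertex k C (simpleOf k C T)))
    (i : T →ₗ[DualAlg k C] V) (p : V →ₗ[DualAlg k C] S.1.carrier)
    (hi : Function.Injective i) (hip : Function.Exact i p) (hp : Function.Surjective p) :
    ∃ s : S.1.carrier →ₗ[DualAlg k C] V, p ∘ₗ s = LinearMap.id := by
  by_contra hs
  let eV := ofRationalEquiv k C V
  let eT := ofRationalEquiv k C T
  refine h.false ⟨S, simpleOf k C T, rfl, rfl, ofRational k C V,
    (eV.toLinearMap ∘ₗ i ∘ₗ eT.symm.toLinearMap).restrictScalars k,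
    (p ∘ₗ eV.symm.toLinearMap).restrictScalars k, Comod.isHom_restrictScalars _,
    Comod.isHom_restrictScalars _, hi, hip, hp, ?_⟩
  rintro ⟨s, hs', hps⟩
  exact hs ⟨eV.symm.toLinearMap ∘ₗ hs'.toLinearMap, LinearMap.ext fun x =>
    LinearMap.congr_fun hps x⟩

end
end Factors

/-! ### The largest submodule with prescribed simple subquotients -/

section Torsion

variable {k : Type u} {C : Type v} [Field k] [AddCommGroup C] [Module k C] [Coalgebra k C]
variable {V : Type v} [AddCommGroup V] [Module (DualAlg k C) V]
  {W : Type v} [AddCommGroup W] [Module (DualAlg k C) W]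

lemma factors_mono {P Q : Submodule (DualAlg k C) V} (h : P ≤ Q) :
    factors k C P ⊆ factors k C Q :=
  factors_subset_of_injective (Submodule.inclusion h) (Submodule.inclusion_injective h)

lemma factors_sup (P Q : Submodule (DualAlg k C) V) :
    factors k C (P ⊔ Q : Submodule (DualAlg k C) V) ⊆ factors k C P ∪ factors k C Q := by
  have h1 : factors k C (P ⊔ Q : Submodule (DualAlg k C) V) ⊆ factors k C (P × Q) := by
    rw [Submodule.sup_eq_range]
    exact factors_subset_of_surjective _ (LinearMap.surjective_rangeRestrict _)
  refine h1.trans ((factors_subset_union (LinearMap.snd (DualAlg k C) P Q)).trans ?_)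
  refine Set.union_subset_union_left _ (factors_subset_of_injective
    (LinearMap.fst (DualAlg k C) P Q ∘ₗ Submodule.subtype _) ?_)
  intro x y hxy
  exact Subtype.ext (Prod.ext hxy ((LinearMap.mem_ker.1 x.2).trans (LinearMap.mem_ker.1 y.2).symm))

variable (V) in
/-- The largest submodule all of whose simple subquotients belong to `X`. -/
def torsion (X : Set (RightGabriel k C)) : Submodule (DualAlg k C) V where
  carrier := {x | factors k C (DualAlg k C ∙ x) ⊆ X}
  add_mem' {x y} hx hy := by
    have h : (DualAlg k C ∙ (x + y)) ≤ (DualAlg k C ∙ x) ⊔ (DualAlg k C ∙ y) := by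
      rw [Submodule.span_singleton_le_iff_mem]
      exact Submodule.add_mem_sup (Submodule.mem_span_singleton_self x)
        (Submodule.mem_span_singleton_self y)
    exact (factors_mono h).trans ((factors_sup _ _).trans (Set.union_subset hx hy))
  zero_mem' := by
    have : Subsingleton (DualAlg k C ∙ (0 : V)) := by
      rw [Submodule.span_zero_singleton]; infer_instance
    change factors k C _ ⊆ X
    rw [factors_eq_empty_of_subsingleton]
    exact Set.empty_subset X
  smul_mem' r x hx := (factors_mono (Submodule.span_singleton_smul_le _ r x)).trans hx

lemma mem_torsion_of_factors_subset {X : Set (RightGabriel k C)} (f : V →ₗ[DualAlg k C] W)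
    (h : factors k C V ⊆ X) (x : V) : f x ∈ torsion W X := by
  have hle : (DualAlg k C ∙ f x) ≤ LinearMap.range f := by
    rw [Submodule.span_singleton_le_iff_mem]
    exact ⟨x, rfl⟩
  exact (factors_mono hle).trans ((factors_subset_of_surjective f.rangeRestrict
    f.surjective_rangeRestrict).trans h)

/-- A simple subquotient is already visible on a cyclic submodule, so the elementwise definition of
`torsion` controls whole submodules. -/
lemma le_torsion_iff {X : Set (RightGabriel k C)} {P : Submodule (DualAlg k C) V} :
    P ≤ torsion V X ↔ factors k C P ⊆ X := by
  constructor
  · intro h x hx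
    obtain ⟨y, hy⟩ := exists_mem_factors_span hx
    refine h y.2 (factors_subset_of_injective ((P.subtype ∘ₗ Submodule.subtype _).codRestrict
      (DualAlg k C ∙ (y : V)) ?_) ?_ hy)
    · rintro ⟨z, hz⟩
      obtain ⟨r, rfl⟩ := Submodule.mem_span_singleton.1 hz
      exact Submodule.smul_mem _ r (Submodule.mem_span_singleton_self _)
    · intro a b hab
      have h' := congrArg Subtype.val hab
      exact Subtype.ext (Subtype.ext h')
  · exact fun h x hx => mem_torsion_of_factors_subset P.subtype h ⟨x, hx⟩

lemma factors_torsion (X : Set (RightGabriel k C)) : factors k C (torsion V X) ⊆ X :=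
  le_torsion_iff.1 le_rfl

lemma map_mem_torsion {X : Set (RightGabriel k C)} (f : V →ₗ[DualAlg k C] W) {x : V}
    (hx : x ∈ torsion V X) : f x ∈ torsion W X :=
  mem_torsion_of_factors_subset (f ∘ₗ (torsion V X).subtype) (factors_torsion X) ⟨x, hx⟩

lemma torsion_univ : torsion V (Set.univ : Set (RightGabriel k C)) = ⊤ :=
  eq_top_iff.2 fun _ _ => Set.subset_univ _

variable [Module k V] [IsScalarTower k (DualAlg k C) V] [IsRational k C V]

variable (k C) in
lemma torsion_inf_torsion {X Y : Set (RightGabriel k C)} (h : Disjoint X Y) :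
    torsion V X ⊓ torsion V Y = ⊥ := by
  by_contra hne
  have : Nontrivial (torsion V X ⊓ torsion V Y : Submodule (DualAlg k C) V) :=
    Submodule.nontrivial_iff_ne_bot.2 hne
  obtain ⟨x, hx⟩ := factors_nonempty k C (torsion V X ⊓ torsion V Y : Submodule (DualAlg k C) V)
  exact Set.disjoint_left.1 h (le_torsion_iff.1 inf_le_left hx) (le_torsion_iff.1 inf_le_right hx)

end Torsion

/-! ### The quotient by the torsion submodule -/

section TorsionQuotient

variable {k : Type u} {C : Type v} [Field k] [AddCommGroup C] [Module k C] [Coalgebra k C]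
variable {V : Type v} [AddCommGroup V] [Module (DualAlg k C) V]

/-- A simple submodule of `V / t_X V` does not have its class in `X`. -/
lemma eq_zero_of_simple_to_quotient_torsion {X : Set (RightGabriel k C)}
    {S : {S : Comod k C // S.IsSimple}} (hS : vertex k C S ∈ X)
    (f : S.1.carrier →ₗ[DualAlg k C] V ⧸ torsion V X) : f = 0 := by
  -- `P` is an extension of the image of `f` by the torsion submodule, so its factors lie in `X` and
  -- it is itself contained in the torsion submodule.
  let P := (LinearMap.range f).comap (torsion V X).mkQ
  have hP : factors k C P ⊆ X := by
    refine (factors_subset_union ((torsion V X).mkQ.submoduleComap (LinearMap.range f))).trans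
      (Set.union_subset ?_ ?_)
    · refine (factors_subset_of_injective ((P.subtype ∘ₗ Submodule.subtype _).codRestrict
        (torsion V X) ?_) ?_).trans (factors_torsion X)
      · intro x
        have := congrArg Subtype.val (LinearMap.mem_ker.1 x.2)
        exact (Submodule.Quotient.mk_eq_zero _).1 this
      · intro a b hab
        have h' := congrArg Subtype.val hab
        exact Subtype.ext (Subtype.ext h')
    · refine (factors_subset_of_surjective f.rangeRestrict f.surjective_rangeRestrict).trans ?_
      rw [factors_simple]
      exact Set.singleton_subset_iff.2 hS
  ext s
  obtain ⟨x, hx⟩ := (torsion V X).mkQ_surjective (f s)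
  have : x ∈ P := by
    change (torsion V X).mkQ x ∈ LinearMap.range f
    rw [hx]; exact ⟨s, rfl⟩
  rw [← hx]
  exact (Submodule.Quotient.mk_eq_zero _).2 (le_torsion_iff.2 hP this)

variable [Module k V] [IsScalarTower k (DualAlg k C) V] [IsRational k C V]

/-- Suppose that no arrow leads from `X` to its complement. If no proper submodule of `V` has a
simple subquotient in `X`, then a surjection from `V` to a simple module in `X` is injective. -/
lemma ker_eq_bot_of_proper {X : Set (RightGabriel k C)} [Module.Finite k V]
    (hX : ∀ x ∈ X, ∀ y ∉ X, IsEmpty (x ⟶ y))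
    (hsmall : ∀ P : Submodule (DualAlg k C) V, P ≠ ⊤ → ∀ x ∈ factors k C P, x ∉ X)
    (S : {S : Comod k C // S.IsSimple}) (hSX : vertex k C S ∈ X)
    (f : V →ₗ[DualAlg k C] S.1.carrier) (hf : f ≠ 0) : LinearMap.ker f = ⊥ := by
  by_contra hK
  have hfs : Function.Surjective f := LinearMap.range_eq_top.1
    ((eq_bot_or_eq_top (LinearMap.range f)).resolve_left fun h => hf (LinearMap.range_eq_bot.1 h))
  have hKtop : LinearMap.ker f ≠ ⊤ := fun h => hf (LinearMap.ker_eq_top.1 h)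
  generalize hKf : LinearMap.ker f = K at hK hKtop
  have : Module.Finite k K := Module.Finite.of_injective (K.subtype.restrictScalars k)
    K.subtype_injective
  have : Nontrivial K := Submodule.nontrivial_iff_ne_bot.2 hK
  -- With `K'` maximal in `K = ker f`, the quotient `V / L` is an extension of `S` by the simple
  -- module `K / K'`, whose vertex lies outside `X`.
  obtain ⟨K', hK'⟩ := exists_isCoatom_of_finite (k := k) (C := C) (V := K)
  let L := K'.map K.subtype
  have hLK : L ≤ K := Submodule.map_subtype_le K K'
  have hy : vertex k C (simpleOf k C (K ⧸ K')) ∉ X := by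
    apply hsmall K hKtop
    apply factors_subset_of_surjective K'.mkQ K'.mkQ_surjective
    rw [factors_of_isSimple]
    rfl
  let i : (K ⧸ K') →ₗ[DualAlg k C] V ⧸ L :=
    K'.mapQ L K.subtype (Submodule.le_comap_map _ _)
  let p : (V ⧸ L) →ₗ[DualAlg k C] S.1.carrier := L.liftQ f (hKf ▸ hLK)
  have hi : Function.Injective i := by
    rw [← LinearMap.ker_eq_bot, Submodule.ker_mapQ, Submodule.comap_map_eq_of_injective
      K.subtype_injective, Submodule.mkQ_map_self]
  have hip : Function.Exact i p := by
    intro z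
    obtain ⟨z, rfl⟩ := L.mkQ_surjective z
    constructor
    · intro hz
      have hzK : z ∈ K := by rw [← hKf]; exact hz
      exact ⟨Submodule.Quotient.mk ⟨z, hzK⟩, rfl⟩
    · rintro ⟨w, hw⟩
      obtain ⟨w, rfl⟩ := K'.mkQ_surjective w
      rw [← hw]
      exact hKf.ge w.2
  have hp : Function.Surjective p := fun s => by
    obtain ⟨x, rfl⟩ := hfs s
    exact ⟨Submodule.Quotient.mk x, rfl⟩
  obtain ⟨s, hs⟩ := exists_section_of_isEmpty_hom (hX _ hSX _ hy) i p hi hip hp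
  -- The preimage of the split copy of `S` is a proper submodule that still maps nontrivially to
  -- `S`, contrary to `hsmall`.
  let P := (LinearMap.range s).comap L.mkQ
  have hPtop : P ≠ ⊤ := by
    intro hP
    have hsurj : ∀ z, ∃ t, s t = z := by
      intro z
      obtain ⟨z, rfl⟩ := L.mkQ_surjective z
      have : z ∈ P := by rw [hP]; trivial
      exact this
    have : Nontrivial (K ⧸ K') :=
      (Submodule.nontrivial_iff (DualAlg k C)).1 hK'.toNontrivial
    obtain ⟨w, hw⟩ := exists_ne (0 : K ⧸ K')
    apply hw
    apply hi
    obtain ⟨t, ht⟩ := hsurj (i w)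
    have h1 : p (i w) = 0 := (hip (i w)).2 ⟨w, rfl⟩
    rw [← ht] at h1 ⊢
    have h2 : t = 0 := (LinearMap.congr_fun hs t).symm.trans h1
    rw [h2, map_zero, map_zero]
  refine hsmall P hPtop _ ?_ hSX
  refine ⟨S, rfl, ⊤, (f ∘ₗ P.subtype) ∘ₗ Submodule.subtype _, fun h0 => ?_⟩
  have := S.2.1
  obtain ⟨t, ht⟩ := exists_ne (0 : S.1.carrier)
  apply ht
  obtain ⟨x, hx⟩ := L.mkQ_surjective (s t)
  have hxP : x ∈ P := ⟨t, hx.symm⟩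
  have h1 : f x = 0 := LinearMap.congr_fun h0 ⟨⟨x, hxP⟩, trivial⟩
  have h2 : p (s t) = t := LinearMap.congr_fun hs t
  rw [← h2, ← hx]
  exact h1

/-- Suppose that no arrow leads from `X` to its complement. If a module has no simple submodule in
`X`, then it has no simple subquotient in `X`. -/
lemma disjoint_factors_of_finite {X : Set (RightGabriel k C)}
    (hX : ∀ x ∈ X, ∀ y ∉ X, IsEmpty (x ⟶ y))
    (hV : ∀ (S : {S : Comod k C // S.IsSimple}) (f : S.1.carrier →ₗ[DualAlg k C] V),
      vertex k C S ∈ X → f = 0) (n : ℕ) :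
    ∀ (N : Submodule (DualAlg k C) V) [Module.Finite k N], Module.finrank k N = n →
      ∀ x ∈ factors k C N, x ∉ X := by
  -- The induction ranges over submodules of the fixed `V`, so `hV` applies unchanged; submodules of
  -- `N₂` are transported to their images in `V`.
  induction n using Nat.strong_induction_on with
  | _ n ih =>
  rintro N _ rfl _ ⟨S, rfl, N₂, f, hf⟩ hSX
  have hfs : Function.Surjective f := LinearMap.range_eq_top.1
    ((eq_bot_or_eq_top (LinearMap.range f)).resolve_left fun h => hf (LinearMap.range_eq_bot.1 h))
  -- a proper submodule of `N₂` has no simple subquotient in `X`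
  have hsmall : ∀ P : Submodule (DualAlg k C) N₂, P ≠ ⊤ → ∀ x ∈ factors k C P, x ∉ X := by
    intro P hP x hx
    have : Module.Finite k N₂ := Module.Finite.of_injective (N₂.subtype.restrictScalars k)
      N₂.subtype_injective
    have : Module.Finite k P := Module.Finite.of_injective (P.subtype.restrictScalars k)
      P.subtype_injective
    let j : P →ₗ[DualAlg k C] V := N.subtype ∘ₗ N₂.subtype ∘ₗ P.subtype
    have hj : Function.Injective j :=
      N.subtype_injective.comp (N₂.subtype_injective.comp P.subtype_injective)
    let e := LinearEquiv.ofInjective j hj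
    have : Module.Finite k (LinearMap.range j) :=
      Module.Finite.equiv (e.restrictScalars k)
    have h1 : Module.finrank k (LinearMap.range j) = Module.finrank k P :=
      (LinearEquiv.finrank_eq (e.restrictScalars k)).symm
    have h2 : Module.finrank k (P.restrictScalars k) < Module.finrank k N₂ := by
      apply Submodule.finrank_lt
      intro h
      apply hP
      exact Submodule.restrictScalars_injective k _ _ h
    have h3 : Module.finrank k N₂ ≤ Module.finrank k N :=
      LinearMap.finrank_le_finrank_of_injective (f := N₂.subtype.restrictScalars k)
        N₂.subtype_injective
    exact ih _ (h1.trans_lt (h2.trans_le h3)) (LinearMap.range j) rfl x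
      ((factors_congr (k := k) (C := C) e).subset hx)
  have : Module.Finite k N₂ := Module.Finite.of_injective (N₂.subtype.restrictScalars k)
    N₂.subtype_injective
  have hK := ker_eq_bot_of_proper hX hsmall S hSX f hf
  let e := LinearEquiv.ofBijective f ⟨LinearMap.ker_eq_bot.1 hK, hfs⟩
  have h0 := hV S (N.subtype ∘ₗ N₂.subtype ∘ₗ e.symm.toLinearMap) hSX
  apply hf
  ext x
  have h1 : ((x : N) : V) = 0 := by
    simpa using LinearMap.congr_fun h0 (e x)
  have h2 : x = 0 := Subtype.ext (Subtype.ext h1)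
  rw [h2, map_zero, map_zero]

/-- If no arrow leads from `X` to its complement, then the simple subquotients of `V / t_X V` belong
to the complement of `X`. -/
lemma factors_quotient_torsion {X : Set (RightGabriel k C)}
    (hX : ∀ x ∈ X, ∀ y ∉ X, IsEmpty (x ⟶ y)) :
    factors k C (V ⧸ torsion V X) ⊆ Xᶜ := by
  intro x hx
  obtain ⟨y, hy⟩ := exists_mem_factors_span hx
  have := finite_span_singleton k C y
  exact disjoint_factors_of_finite hX
    (fun S f hS => eq_zero_of_simple_to_quotient_torsion hS f) _ _ rfl x hy

end TorsionQuotient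

/-! ### Subcoalgebras and wedge products in terms of the dual algebra -/

lemma slice_map {k V W C D : Type*} [Field k] [AddCommGroup V] [Module k V] [AddCommGroup W]
    [Module k W] [AddCommGroup C] [Module k C] [AddCommGroup D] [Module k D]
    (f : D →ₗ[k] k) (h : V →ₗ[k] W) (j : C →ₗ[k] D) (t : V ⊗[k] C) :
    slice W f (TensorProduct.map h j t) = h (slice V (f ∘ₗ j) t) := by
  induction t with
  | zero => simp
  | add x y hx hy => simp only [map_add, hx, hy]
  | tmul x c => simp

section Annihilator

variable {k : Type u} {C : Type v} [Field k] [AddCommGroup C] [Module k C] [Coalgebra k C]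

@[ext]
lemma DualAlg.ext {f g : DualAlg k C} (h : ∀ c, f.fn c = g.fn c) : f = g :=
  WithConv.ofConv_injective (LinearMap.ext h)

/-- The functionals that vanish on a subspace of `C`. -/
def ann (A : Submodule k C) : Set (DualAlg k C) := {f | ∀ a ∈ A, f.fn a = 0}

/-- The action `∑ c₁ f(c₂)` of the dual algebra on the coalgebra. -/
def act (f : DualAlg k C) (c : C) : C := slice C f.fn (Coalgebra.comul c)

lemma mul_fn (f g : DualAlg k C) (c : C) : (f * g).fn c = f.fn (act g c) := DualAlg.mul_apply f g c

lemma counit_act (f : DualAlg k C) (c : C) : Coalgebra.counit (R := k) (act f c) = f.fn c :=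
  ev_one_smul f (toRegular k C c)

lemma mem_of_ann {A : Submodule k C} {c : C} (h : ∀ f ∈ ann A, f.fn c = 0) : c ∈ A := by
  by_contra hc
  obtain ⟨f, hfc, hf⟩ := Submodule.exists_le_ker_of_notMem hc
  exact hfc (h (DualAlg.of f) fun a ha => hf ha)

lemma ann_anti {A B : Submodule k C} (h : A ≤ B) : ann B ⊆ ann A := fun _ hf a ha => hf a (h ha)

lemma sub_mem_ann {A : Submodule k C} {f g : DualAlg k C} (hf : f ∈ ann A) (hg : g ∈ ann A) :
    f - g ∈ ann A := fun a ha => by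
  change f.fn a - g.fn a = 0
  rw [hf a ha, hg a ha, sub_zero]

/-- The two conditions say that `Δ(A)` lies in `A ⊗ C` and in `C ⊗ A`. A linear projection of `C`
onto `A` combines them into `A ⊗ A`. -/
lemma isSubcoalgebra_iff {A : Submodule k C} : IsSubcoalgebra k A ↔
    (∀ f : DualAlg k C, ∀ a ∈ A, act f a ∈ A) ∧ ∀ f ∈ ann A, ∀ a ∈ A, act f a = 0 := by
  constructor
  · intro h
    constructor
    · intro f a ha
      obtain ⟨t, ht⟩ := h a ha
      rw [act, ← ht, slice_map]
      exact Subtype.coe_prop _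
    · intro f hf a ha
      obtain ⟨t, ht⟩ := h a ha
      rw [act, ← ht, slice_map]
      have : f.fn ∘ₗ A.subtype = 0 := LinearMap.ext fun x => hf x x.2
      rw [this]
      simp [slice]
  · rintro ⟨h1, h2⟩ a ha
    obtain ⟨s, hs⟩ := mem_range_of_slice (N := A) (t := Coalgebra.comul (R := k) a)
      fun f => h1 (DualAlg.of f) a ha
    obtain ⟨p, hp⟩ := LinearMap.exists_leftInverse_of_injective A.subtype
      (LinearMap.ker_eq_bot.2 A.subtype_injective)
    -- For every functional `f`, the difference `f - f ∘ p` vanishes on `A`, so the second condition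
    -- makes its slice of `Δ a` zero.
    have h3 : Coalgebra.comul (R := k) a =
        TensorProduct.map LinearMap.id (A.subtype ∘ₗ p) (Coalgebra.comul (R := k) a) := by
      apply eq_of_slice
      intro f
      rw [slice_map, LinearMap.id_apply, ← sub_eq_zero]
      refine Eq.trans ?_ (h2 (DualAlg.of f - DualAlg.of (f ∘ₗ A.subtype ∘ₗ p)) ?_ a ha)
      · change _ = slice C (f - f ∘ₗ A.subtype ∘ₗ p) _
        simp [slice, LinearMap.lTensor_sub]
      · intro b hb
        have : p b = ⟨b, hb⟩ := LinearMap.congr_fun hp ⟨b, hb⟩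
        change f b - f (A.subtype (p b)) = 0
        rw [this, Submodule.subtype_apply, sub_self]
    refine ⟨p.lTensor A s, ?_⟩
    rw [h3, ← hs]
    simp only [LinearMap.lTensor, LinearMap.rTensor, ← LinearMap.comp_apply,
      ← TensorProduct.map_comp, LinearMap.comp_id, LinearMap.id_comp]

/-- Functionals on `C / B` are the elements of `ann B`, and slices separate the tensors in `C / A ⊗
C / B`. -/
lemma mem_wedge_iff {A B : Submodule k C} {c : C} :
    c ∈ wedge k A B ↔ ∀ f ∈ ann B, act f c ∈ A := by
  rw [wedge, LinearMap.mem_ker, LinearMap.comp_apply]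
  constructor
  · intro h f hf
    rw [← Submodule.Quotient.mk_eq_zero]
    have h1 := slice_map (B.liftQ f.fn (show B ≤ LinearMap.ker f.fn from hf)) A.mkQ B.mkQ
      (Coalgebra.comul (R := k) c)
    rw [h, map_zero, Submodule.liftQ_mkQ] at h1
    exact h1.symm
  · intro h
    apply eq_zero_of_slice
    intro f
    rw [slice_map]
    refine (Submodule.Quotient.mk_eq_zero _).2 (h (DualAlg.of (f ∘ₗ B.mkQ)) fun b hb => ?_)
    change f (B.mkQ b) = 0
    rw [Submodule.mkQ_apply, (Submodule.Quotient.mk_eq_zero B).2 hb, map_zero]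

lemma wedge_mono {A A' B B' : Submodule k C} (hA : A ≤ A') (hB : B ≤ B') :
    wedge k A B ≤ wedge k A' B' := fun _ hc =>
  mem_wedge_iff.2 fun f hf => hA (mem_wedge_iff.1 hc f (ann_anti hB hf))

lemma IsSubcoalgebra.act_mem {A : Submodule k C} (hA : IsSubcoalgebra k A) (f : DualAlg k C)
    {a : C} (ha : a ∈ A) : act f a ∈ A := (isSubcoalgebra_iff.1 hA).1 f a ha

lemma IsSubcoalgebra.act_eq_zero {A : Submodule k C} (hA : IsSubcoalgebra k A) {f : DualAlg k C}
    (hf : f ∈ ann A) {a : C} (ha : a ∈ A) : act f a = 0 := (isSubcoalgebra_iff.1 hA).2 f hf a ha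

lemma act_add (f : DualAlg k C) (c d : C) : act f (c + d) = act f c + act f d := by
  simp [act]

lemma IsSubcoalgebra.sup {A B : Submodule k C} (hA : IsSubcoalgebra k A)
    (hB : IsSubcoalgebra k B) : IsSubcoalgebra k (A ⊔ B) := by
  rw [isSubcoalgebra_iff]
  constructor
  · intro f c hc
    obtain ⟨a, ha, b, hb, rfl⟩ := Submodule.mem_sup.1 hc
    rw [act_add]
    exact Submodule.add_mem_sup (hA.act_mem f ha) (hB.act_mem f hb)
  · intro f hf c hc
    obtain ⟨a, ha, b, hb, rfl⟩ := Submodule.mem_sup.1 hc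
    rw [act_add, hA.act_eq_zero (ann_anti le_sup_left hf) ha,
      hB.act_eq_zero (ann_anti le_sup_right hf) hb, add_zero]

lemma wedge_eq_top_of_sup {A B : Submodule k C} (hA : IsSubcoalgebra k A)
    (hB : IsSubcoalgebra k B) (h : A ⊔ B = ⊤) : wedge k A B = ⊤ := by
  rw [eq_top_iff]
  intro c _
  obtain ⟨a, ha, b, hb, rfl⟩ := Submodule.mem_sup.1 (show c ∈ A ⊔ B by rw [h]; trivial)
  rw [mem_wedge_iff]
  intro f hf
  rw [act_add, hB.act_eq_zero hf hb, add_zero]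
  exact hA.act_mem f ha

lemma IsSubcoalgebra.mul_mem_ann_left {A : Submodule k C} (hA : IsSubcoalgebra k A)
    {f : DualAlg k C} (hf : f ∈ ann A) (g : DualAlg k C) : g * f ∈ ann A := fun a ha => by
  rw [mul_fn, hA.act_eq_zero hf ha, map_zero]

lemma IsSubcoalgebra.mul_mem_ann_right {A : Submodule k C} (hA : IsSubcoalgebra k A)
    {f : DualAlg k C} (hf : f ∈ ann A) (g : DualAlg k C) : f * g ∈ ann A := fun a ha => by
  rw [mul_fn, hf _ (hA.act_mem g ha)]

lemma mul_eq_zero_of_wedge {A B : Submodule k C} (h : wedge k A B = ⊤) {f g : DualAlg k C}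
    (hf : f ∈ ann A) (hg : g ∈ ann B) : f * g = 0 := by
  ext c
  rw [mul_fn]
  exact hf _ (mem_wedge_iff.1 (h ▸ Submodule.mem_top) g hg)

/-- Disjoint subspaces are separated by an element of the dual algebra. -/
lemma exists_separating {A B : Submodule k C} (h : A ⊓ B = ⊥) :
    ∃ e : DualAlg k C, e ∈ ann B ∧ 1 - e ∈ ann A := by
  have hinj : LinearMap.ker (B.mkQ ∘ₗ A.subtype) = ⊥ := by
    rw [LinearMap.ker_eq_bot']
    intro a ha
    have hb : (a : C) ∈ B := (Submodule.Quotient.mk_eq_zero B).1 ha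
    have : (a : C) ∈ A ⊓ B := ⟨a.2, hb⟩
    rw [h, Submodule.mem_bot] at this
    exact Subtype.ext this
  obtain ⟨q, hq⟩ := LinearMap.exists_leftInverse_of_injective _ hinj
  -- The counit, which is the unit of the dual algebra, composed with a linear projection onto `A`
  -- that kills `B`.
  refine ⟨DualAlg.of (Coalgebra.counit ∘ₗ A.subtype ∘ₗ q ∘ₗ B.mkQ), fun b hb => ?_, fun a ha => ?_⟩
  · change Coalgebra.counit (A.subtype (q (B.mkQ b))) = 0
    rw [Submodule.mkQ_apply, (Submodule.Quotient.mk_eq_zero B).2 hb, map_zero, map_zero, map_zero]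
  · change Coalgebra.counit a - Coalgebra.counit (A.subtype (q (B.mkQ a))) = (0 : k)
    have : q (B.mkQ a) = ⟨a, ha⟩ := LinearMap.congr_fun hq ⟨a, ha⟩
    rw [this, Submodule.subtype_apply, sub_self]

end Annihilator

/-! ### Comodules over a subcoalgebra -/

section Over

variable {k : Type u} {C : Type v} [Field k] [AddCommGroup C] [Module k C] [Coalgebra k C]

/-- A module over the dual algebra is a module over the dual of the subcoalgebra `A`. -/
def IsOver (A : Submodule k C) (V : Type v) [AddCommGroup V] [Module (DualAlg k C) V] : Prop :=
  ∀ f ∈ ann A, ∀ x : V, f • x = 0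

variable {V : Type v} [AddCommGroup V] [Module (DualAlg k C) V]
  {W : Type v} [AddCommGroup W] [Module (DualAlg k C) W]

lemma IsOver.of_injective {A : Submodule k C} (h : IsOver A W) (i : V →ₗ[DualAlg k C] W)
    (hi : Function.Injective i) : IsOver A V := fun f hf x =>
  hi (by rw [map_smul, h f hf, map_zero])

lemma IsOver.of_surjective {A : Submodule k C} (h : IsOver A V) (p : V →ₗ[DualAlg k C] W)
    (hp : Function.Surjective p) : IsOver A W := fun f hf y => by
  obtain ⟨x, rfl⟩ := hp y
  rw [← map_smul, h f hf, map_zero]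

/-- The vertices of the simple comodules over `A`. -/
def overVertices (A : Submodule k C) : Set (RightGabriel k C) :=
  {x | ∃ S, vertex k C S = x ∧ IsOver A S.1.carrier}

lemma vertex_mem_overVertices_iff {A : Submodule k C} {S : {S : Comod k C // S.IsSimple}} :
    vertex k C S ∈ overVertices A ↔ IsOver A S.1.carrier := by
  constructor
  · rintro ⟨T, hT, h⟩
    obtain ⟨e⟩ := vertex_eq_iff.1 hT
    exact h.of_surjective e.toLinearMap e.surjective
  · exact fun h => ⟨S, rfl, h⟩

/-- If `C = A ∧ B` with `A ∩ B = 0`, then `Ext¹(S, T) = 0` for simple comodules `S` over `A` and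
`T` over `B`. -/
lemma isEmpty_hom_of_wedge {A B : Submodule k C} (hB : IsSubcoalgebra k B)
    (hAB : A ⊓ B = ⊥) (hw : wedge k A B = ⊤) {x y : RightGabriel k C} (hx : x ∈ overVertices A)
    (hy : y ∈ overVertices B) : IsEmpty (x ⟶ y) := by
  constructor
  rintro ⟨S, T, rfl, rfl, M, i, p, hi, hp, hinj, hip, hsurj, hs⟩
  replace hx : IsOver A S.1.carrier := vertex_mem_overVertices_iff.1 hx
  replace hy : IsOver B T.1.carrier := vertex_mem_overVertices_iff.1 hy
  obtain ⟨e, heB, heA⟩ := exists_separating hAB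
  -- The element `e` acts as `1` on `S` and as `0` on `T`. Once its action on `M` is known to be
  -- linear over the dual algebra, it factors through `S` and provides the section.
  have hi' := Comod.isHom_iff.1 hi
  have hp' := Comod.isHom_iff.1 hp
  have heS : ∀ s : S.1.carrier, e • s = s := fun s => by
    have := hx _ heA s
    rw [sub_smul, one_smul, sub_eq_zero] at this
    exact this.symm
  have hker : ∀ m : M.carrier, p m = 0 → e • m = 0 := fun m hm => by
    obtain ⟨t, rfl⟩ := (hip m).1 hm
    rw [← hi', hy e heB, map_zero]
  -- The commutator `e * r - r * e` lies in `ann B`, so `1 - e ∈ ann A` kills it. It also maps `M`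
  -- into `ker p`, where `e` acts as zero. Adding the two, it acts as zero on `M`.
  have hcomm : ∀ (r : DualAlg k C) (m : M.carrier), e • r • m = r • e • m := fun r m => by
    have h1 : e * r - r * e ∈ ann B :=
      sub_mem_ann (hB.mul_mem_ann_right heB r) (hB.mul_mem_ann_left heB r)
    have h2 : (e * r - r * e) • m = 0 := by
      have h3 : (1 - e) * (e * r - r * e) = 0 := mul_eq_zero_of_wedge hw heA h1
      have h4 : e • (e * r - r * e) • m = 0 := by
        apply hker
        rw [hp', sub_smul, mul_smul, mul_smul, heS, heS, sub_self]
      have h5 := congrArg (· • m) h3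
      simp only [mul_smul (1 - e), sub_smul 1 e, one_smul, h4, zero_smul, sub_zero] at h5
      exact h5
    rwa [sub_smul, mul_smul, mul_smul, sub_eq_zero] at h2
  let E : M.carrier →ₗ[DualAlg k C] M.carrier :=
    { toFun := fun m => e • m
      map_add' := smul_add e
      map_smul' := hcomm }
  let P := hp.toLinearMap
  have hle : LinearMap.ker P ≤ LinearMap.ker E := fun m hm => hker m hm
  let σ := (LinearMap.ker P).liftQ E hle ∘ₗ
    (P.quotKerEquivOfSurjective hsurj).symm.toLinearMap
  refine hs ⟨σ.restrictScalars k, Comod.isHom_restrictScalars σ, LinearMap.ext fun s => ?_⟩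
  obtain ⟨m, rfl⟩ := hsurj s
  have h1 : (P.quotKerEquivOfSurjective hsurj).symm (p m) = Submodule.Quotient.mk m := by
    rw [LinearEquiv.symm_apply_eq]; rfl
  change p ((LinearMap.ker P).liftQ E hle ((P.quotKerEquivOfSurjective hsurj).symm (p m))) = p m
  rw [h1]
  change p (e • m) = p m
  rw [hp', heS]

end Over

/-! ### The subcoalgebra of a set of vertices -/

section CoalgPart

variable {k : Type u} {C : Type v} [Field k] [AddCommGroup C] [Module k C] [Coalgebra k C]

/-- The largest subcoalgebra whose simple comodules belong to `X`. -/
def coalgPart (X : Set (RightGabriel k C)) : Submodule k C :=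
  ((torsion (regular k C).carrier X).restrictScalars k).comap (toRegular k C).toLinearMap

lemma mem_coalgPart {X : Set (RightGabriel k C)} {c : C} :
    c ∈ coalgPart X ↔ toRegular k C c ∈ torsion (regular k C).carrier X := Iff.rfl

section
variable {V : Type v} [AddCommGroup V] [Module k V] [Module (DualAlg k C) V]
  [IsScalarTower k (DualAlg k C) V] [IsRational k C V]

/-- The matrix coefficients of a torsion element are torsion in the regular comodule, so they lie in
`coalgPart X`, where `f` vanishes. -/
lemma smul_eq_zero_of_mem_torsion {X : Set (RightGabriel k C)} {f : DualAlg k C}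
    (hf : f ∈ ann (coalgPart X)) {x : V} (hx : x ∈ torsion V X) : f • x = 0 := by
  apply smul_eq_zero_of_coeff
  intro φ
  have h : coeff φ x ∈ torsion (regular k C).carrier X := map_mem_torsion (coeff φ) hx
  exact hf ((toRegular k C).symm (coeff φ x)) h

lemma isOver_coalgPart {X : Set (RightGabriel k C)} (h : factors k C V ⊆ X) :
    IsOver (coalgPart X) V := fun _ hf x =>
  smul_eq_zero_of_mem_torsion hf (mem_torsion_of_factors_subset LinearMap.id h x)

end

lemma isSubcoalgebra_coalgPart (X : Set (RightGabriel k C)) : IsSubcoalgebra k (coalgPart X) :=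
  isSubcoalgebra_iff.2 ⟨fun f _ ha => Submodule.smul_mem _ f (mem_coalgPart.1 ha),
    fun _ hf _ ha => smul_eq_zero_of_mem_torsion hf (mem_coalgPart.1 ha)⟩

lemma coalgPart_univ : coalgPart (Set.univ : Set (RightGabriel k C)) = ⊤ := by
  rw [coalgPart, torsion_univ]
  rfl

lemma subset_overVertices_coalgPart (X : Set (RightGabriel k C)) :
    X ⊆ overVertices (coalgPart X) := by
  intro x hx
  obtain ⟨S, rfl⟩ := Quotient.exists_rep x
  refine vertex_mem_overVertices_iff.2 (isOver_coalgPart ?_)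
  rw [factors_simple]
  exact Set.singleton_subset_iff.2 hx

lemma coalgPart_inf {X Y : Set (RightGabriel k C)} (h : Disjoint X Y) :
    coalgPart X ⊓ coalgPart Y = ⊥ := by
  rw [eq_bot_iff]
  rintro c ⟨hX, hY⟩
  have : toRegular k C c ∈ torsion (regular k C).carrier X ⊓ torsion (regular k C).carrier Y :=
    ⟨hX, hY⟩
  rw [torsion_inf_torsion k C h] at this
  exact this

/-- The factors of `C / torsion C X` lie in `Xᶜ`, so `ann (coalgPart Xᶜ)` kills this quotient, that
is, carries `C` into `coalgPart X`. -/
lemma wedge_coalgPart {X : Set (RightGabriel k C)} (hX : ∀ x ∈ X, ∀ y ∉ X, IsEmpty (x ⟶ y)) :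
    wedge k (coalgPart X) (coalgPart Xᶜ) = ⊤ := by
  rw [eq_top_iff]
  intro c _
  rw [mem_wedge_iff]
  intro f hf
  have h := isOver_coalgPart (factors_quotient_torsion (V := (regular k C).carrier) hX) f hf
    (Submodule.Quotient.mk (toRegular k C c))
  exact (Submodule.Quotient.mk_eq_zero _).1 h

lemma coalgPart_ne_bot {X : Set (RightGabriel k C)} (hX : X.Nonempty) : coalgPart X ≠ ⊥ := by
  obtain ⟨x, hx⟩ := hX
  intro h
  obtain ⟨S, rfl, hS⟩ := subset_overVertices_coalgPart X hx
  rw [h] at hS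
  have := S.2.1
  obtain ⟨s, hs⟩ := exists_ne (0 : S.1.carrier)
  apply hs
  rw [← one_smul (DualAlg k C) s]
  refine hS 1 (fun a ha => ?_) s
  rw [(Submodule.mem_bot k).1 ha, map_zero]

/-! ### Semiprime coalgebras -/

lemma IsSemiprime.coalgPart_sup (hC : IsSemiprime k C) {X : Set (RightGabriel k C)}
    (hX : ∀ x ∈ X, ∀ y ∉ X, IsEmpty (x ⟶ y)) : coalgPart X ⊔ coalgPart Xᶜ = ⊤ :=
  hC _ ((isSubcoalgebra_coalgPart X).sup (isSubcoalgebra_coalgPart Xᶜ))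
    (top_le_iff.1 ((wedge_coalgPart hX).ge.trans (wedge_mono le_sup_left le_sup_right)))

/-- The sum of `coalgPart X` and `coalgPart Xᶜ` is all of `C`, so their wedge in the reverse order
is `C` as well. -/
lemma IsSemiprime.isEmpty_hom (hC : IsSemiprime k C) {X : Set (RightGabriel k C)}
    (hX : ∀ x ∈ X, ∀ y ∉ X, IsEmpty (x ⟶ y)) : ∀ x ∉ X, ∀ y ∈ X, IsEmpty (x ⟶ y) := by
  intro x hx y hy
  have hsup := hC.coalgPart_sup hX
  rw [sup_comm] at hsup
  exact isEmpty_hom_of_wedge (isSubcoalgebra_coalgPart X)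
    (coalgPart_inf disjoint_compl_left)
    (wedge_eq_top_of_sup (isSubcoalgebra_coalgPart _) (isSubcoalgebra_coalgPart _) hsup)
    (subset_overVertices_coalgPart _ hx) (subset_overVertices_coalgPart _ hy)

end CoalgPart

/-! ### Hereditary coalgebras -/

section Hereditary

variable {k : Type u} {C : Type v} [Field k] [AddCommGroup C] [Module k C] [Coalgebra k C]

lemma RatInjective.ofRational
    {V : Type v} [AddCommGroup V] [Module k V] [Module (DualAlg k C) V]
    [IsScalarTower k (DualAlg k C) V] [IsRational k C V]
    (h : RatInjective k C V) : RatInjective k C (ofRational k C V).carrier :=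
  RatInjective.of_extend fun M N i f hi => by
    obtain ⟨g, hg⟩ := h.extend i hi ((ofRationalEquiv k C V).symm.toLinearMap ∘ₗ f)
    exact ⟨(ofRationalEquiv k C V).toLinearMap ∘ₗ g, fun x => hg x⟩

/-- The vertices of the simple comodules that embed into an injective comodule which is a comodule
over `A`. -/
def injOver (A : Submodule k C) : Set (RightGabriel k C) :=
  {x | ∃ S, vertex k C S = x ∧ ∃ I : Comod k C, RatInjective k C I.carrier ∧ IsOver A I.carrier ∧
    ∃ j : S.1.carrier →ₗ[DualAlg k C] I.carrier, Function.Injective j}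

lemma exists_injective_of_mem_injOver {A : Submodule k C} {S : {S : Comod k C // S.IsSimple}}
    (h : vertex k C S ∈ injOver A) :
    ∃ I : Comod k C, RatInjective k C I.carrier ∧ IsOver A I.carrier ∧
      ∃ j : S.1.carrier →ₗ[DualAlg k C] I.carrier, Function.Injective j := by
  obtain ⟨T, hT, I, hI, hA, j, hj⟩ := h
  obtain ⟨e⟩ := vertex_eq_iff.1 hT
  exact ⟨I, hI, hA, j ∘ₗ e.symm.toLinearMap, hj.comp e.symm.injective⟩

/-- Extend `T → I` to the nonsplit extension `M` of `S` by `T`. The extension is injective, so `S ≅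
M / T` embeds in `I / T`, which is injective by heredity and still over `A`. -/
lemma mem_injOver_of_hom (hered : IsRightHereditary k C) {A : Submodule k C}
    {x y : RightGabriel k C} (f : x ⟶ y) (hy : y ∈ injOver A) : x ∈ injOver A := by
  obtain ⟨S, T, rfl, rfl, M, i', p', hi, hp, hinj, hip, hsurj, hs⟩ := f
  obtain ⟨I, hI, hA, j, hj⟩ := exists_injective_of_mem_injOver (S := T) hy
  let i := hi.toLinearMap
  let p := hp.toLinearMap
  obtain ⟨w, hw⟩ := hI.extend i hinj j
  have hker : ∀ m, w m = 0 → p m = 0 → m = 0 := fun m hm hpm => by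
    obtain ⟨t, rfl⟩ := (hip m).1 hpm
    have h1 : j t = 0 := (hw t).symm.trans hm
    have h2 : t = 0 := hj (h1.trans (map_zero j).symm)
    rw [h2, map_zero]
  -- The kernel of `w` meets `T` trivially, hence embeds in `S`; were it nonzero, it would map
  -- isomorphically onto `S` and split the sequence.
  have hwinj : Function.Injective w := by
    rw [← LinearMap.ker_eq_bot]
    by_contra hne
    let q := p ∘ₗ (LinearMap.ker w).subtype
    have hq : Function.Injective q := by
      rw [← LinearMap.ker_eq_bot, LinearMap.ker_eq_bot']
      exact fun m hm => Subtype.ext (hker m m.2 hm)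
    have hqs : Function.Surjective q := by
      rw [← LinearMap.range_eq_top]
      refine (eq_bot_or_eq_top (LinearMap.range q)).resolve_left fun h => hne ?_
      rw [eq_bot_iff]
      intro m hm
      have h0 : q ⟨m, hm⟩ = 0 := LinearMap.congr_fun (LinearMap.range_eq_bot.1 h) _
      exact hker m hm h0
    let e := LinearEquiv.ofBijective q ⟨hq, hqs⟩
    exact hs ⟨((LinearMap.ker w).subtype ∘ₗ e.symm.toLinearMap).restrictScalars k,
      Comod.isHom_restrictScalars _, LinearMap.ext fun s => e.apply_symm_apply s⟩
  let L := LinearMap.range j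
  have hle : LinearMap.ker p ≤ L.comap w := fun m hm => by
    obtain ⟨t, rfl⟩ := (hip m).1 hm
    exact ⟨t, (hw t).symm⟩
  have hge : L.comap w ≤ LinearMap.ker p := by
    rintro m ⟨t, ht⟩
    rw [← hw t] at ht
    rw [← hwinj ht]
    exact (hip _).2 ⟨t, rfl⟩
  have hmap : Function.Injective ((LinearMap.ker p).mapQ L w hle) := by
    rw [← LinearMap.ker_eq_bot, Submodule.ker_mapQ, eq_bot_iff, Submodule.map_le_iff_le_comap]
    intro m hm
    exact (Submodule.Quotient.mk_eq_zero _).2 (hge hm)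
  let e := ofRationalEquiv k C (I.carrier ⧸ L)
  let e' := (p.quotKerEquivOfSurjective hsurj).symm
  exact ⟨S, rfl, ofRational k C (I.carrier ⧸ L), (hI.quotient hered L).ofRational,
    (hA.of_surjective L.mkQ L.mkQ_surjective).of_surjective e.toLinearMap e.surjective,
    e.toLinearMap ∘ₗ (LinearMap.ker p).mapQ L w hle ∘ₗ e'.toLinearMap,
    e.injective.comp (hmap.comp e'.injective)⟩

lemma mem_injOver_of_path (hered : IsRightHereditary k C) {A : Submodule k C}
    {x y : RightGabriel k C} (f : Quiver.Path x y) (hy : y ∈ injOver A) : x ∈ injOver A := by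
  induction f with
  | nil => exact hy
  | cons _ g ih => exact ih (mem_injOver_of_hom hered g hy)

/-- A finite-dimensional comodule whose simple subquotients embed into injective comodules over `A`
is a comodule over `A`. -/
lemma isOver_of_factors_subset {A : Submodule k C}
    {V : Type v} [AddCommGroup V] [Module k V] [Module (DualAlg k C) V]
    [IsScalarTower k (DualAlg k C) V] [IsRational k C V] [Module.Finite k V]
    (hV : factors k C V ⊆ injOver A) (n : ℕ) :
    ∀ (I : Type v) [AddCommGroup I] [Module k I] [Module (DualAlg k C) I]
    [IsScalarTower k (DualAlg k C) I] [IsRational k C I], RatInjective k C I → IsOver A I →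
    ∀ φ : V →ₗ[DualAlg k C] I,
      Module.finrank k ((LinearMap.ker φ).restrictScalars k) = n → IsOver A V := by
  induction n using Nat.strong_induction_on with
  | _ n ih =>
  rintro I _ _ _ _ _ hI hA φ rfl
  by_cases hφ : LinearMap.ker φ = ⊥
  · exact hA.of_injective φ (LinearMap.ker_eq_bot.1 hφ)
  have : Nontrivial (LinearMap.ker φ) := Submodule.nontrivial_iff_ne_bot.2 hφ
  obtain ⟨T, hT⟩ := exists_simple_le k C (V := LinearMap.ker φ)
  let i : T →ₗ[DualAlg k C] V := (LinearMap.ker φ).subtype ∘ₗ T.subtype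
  have hi : Function.Injective i := (LinearMap.ker φ).subtype_injective.comp T.subtype_injective
  have hx : vertex k C (simpleOf k C T) ∈ injOver A := by
    apply hV
    apply factors_subset_of_injective i hi
    rw [factors_of_isSimple]
    rfl
  obtain ⟨I', hI', hA', j, hj⟩ := exists_injective_of_mem_injOver hx
  obtain ⟨ψ, hψ⟩ := hI'.extend i hi (j ∘ₗ (ofRationalEquiv k C T).toLinearMap)
  -- The added component `ψ` is injective on the simple submodule `T` of `ker φ`, so the kernel
  -- strictly shrinks.
  refine ih _ ?_ (I × I'.carrier) (hI.prod hI') ?_ (φ.prod ψ) rfl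
  · apply Submodule.finrank_lt_finrank_of_lt
    rw [lt_iff_le_and_ne]
    constructor
    · intro x hx
      exact congrArg Prod.fst (LinearMap.mem_ker.1 hx)
    · intro heq
      have : Nontrivial T := (Submodule.nontrivial_iff (DualAlg k C)).1 hT.toNontrivial
      obtain ⟨t, ht⟩ := exists_ne (0 : T)
      have h1 : i t ∈ (LinearMap.ker φ).restrictScalars k := (t : LinearMap.ker φ).2
      rw [← heq] at h1
      have h2 : ψ (i t) = 0 := congrArg Prod.snd (LinearMap.mem_ker.1 h1)
      rw [hψ] at h2
      exact ht (hj (h2.trans (map_zero j).symm))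
  · intro f hf x
    exact Prod.ext (hA f hf x.1) (hA' f hf x.2)

/-- A subcoalgebra as a submodule of the regular comodule. -/
def IsSubcoalgebra.toSubmodule {A : Submodule k C} (hA : IsSubcoalgebra k A) :
    Submodule (DualAlg k C) (regular k C).carrier where
  carrier := {c | (toRegular k C).symm c ∈ A}
  add_mem' ha hb := A.add_mem ha hb
  zero_mem' := A.zero_mem
  smul_mem' f _ ha := hA.act_mem f ha

/-- If the vertices in `X` are joined by paths and `X` is not linked to its complement, then the
subcoalgebra of `X` in a hereditary coalgebra is prime. -/
theorem coalgPart_prime (hered : IsRightHereditary k C) {X : Set (RightGabriel k C)}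
    (hX : coalgPart X ⊔ coalgPart Xᶜ = ⊤)
    (hpath : ∀ x ∈ X, ∀ y ∈ X, Nonempty (Quiver.Path x y))
    {A B : Submodule k C} (hA : IsSubcoalgebra k A)
    (hAX : A ≤ coalgPart X) (hw : coalgPart X ≤ wedge k A B) :
    coalgPart X ≤ A ∨ coalgPart X ≤ B := by
  rw [or_iff_not_imp_left]
  intro hnot
  -- Dividing `C` by `A` together with the complement of `coalgPart X` yields `coalgPart X / A` as a
  -- quotient of `C`. Heredity of `C` thus applies directly and need not be passed on to `coalgPart
  -- X`.
  let N := hA.toSubmodule ⊔ torsion (regular k C).carrier Xᶜ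
  have hN : N ≠ ⊤ := by
    intro hN
    apply hnot
    intro d hd
    have h1 : toRegular k C d ∈ N := by rw [hN]; trivial
    obtain ⟨a, ha, b, hb, hab⟩ := Submodule.mem_sup.1 h1
    have hb' : (toRegular k C).symm b ∈ coalgPart X ⊓ coalgPart Xᶜ := by
      refine ⟨?_, hb⟩
      have : (toRegular k C).symm b = d - (toRegular k C).symm a := by
        rw [eq_sub_iff_add_eq, ← map_add, add_comm, hab, LinearEquiv.symm_apply_apply]
      rw [this]
      exact Submodule.sub_mem _ hd (hAX ha)
    rw [coalgPart_inf disjoint_compl_right] at hb'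
    have hb0 : b = 0 := hb'
    rw [hb0, add_zero] at hab
    rw [hab] at ha
    exact ha
  have : Nontrivial ((regular k C).carrier ⧸ N) := Submodule.Quotient.nontrivial_iff.2 hN
  have hsplit : ∀ z : (regular k C).carrier, ∃ d ∈ torsion (regular k C).carrier X,
      ∃ d' ∈ torsion (regular k C).carrier Xᶜ, d + d' = z := fun z => by
    have h : (toRegular k C).symm z ∈ coalgPart X ⊔ coalgPart Xᶜ := by rw [hX]; trivial
    obtain ⟨d, hd, d', hd', h⟩ := Submodule.mem_sup.1 h
    exact ⟨d, hd, d', hd', h⟩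
  have hinj : RatInjective k C ((regular k C).carrier ⧸ N) :=
    (ratInjective_regular k C).quotient hered N
  have hover : IsOver B ((regular k C).carrier ⧸ N) := by
    intro f hf z
    obtain ⟨z, rfl⟩ := N.mkQ_surjective z
    obtain ⟨d, hd, d', hd', rfl⟩ := hsplit z
    rw [← map_smul, smul_add]
    exact (Submodule.Quotient.mk_eq_zero N).2 (Submodule.add_mem_sup
      (mem_wedge_iff.1 (hw hd) f hf) (Submodule.smul_mem _ f hd'))
  have hfac : factors k C ((regular k C).carrier ⧸ N) ⊆ X := by
    refine (factors_subset_of_surjective (N.mkQ ∘ₗ (torsion (regular k C).carrier X).subtype)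
      fun z => ?_).trans (factors_torsion X)
    obtain ⟨z, rfl⟩ := N.mkQ_surjective z
    obtain ⟨d, hd, d', hd', rfl⟩ := hsplit z
    refine ⟨⟨d, hd⟩, (Submodule.Quotient.eq N).2 ?_⟩
    rw [Submodule.subtype_apply, sub_add_cancel_left]
    exact N.neg_mem (Submodule.mem_sup_right hd')
  obtain ⟨T, hT⟩ := exists_simple_le k C (V := (regular k C).carrier ⧸ N)
  have hTX : vertex k C (simpleOf k C T) ∈ X := by
    apply hfac
    apply factors_subset_of_injective T.subtype T.subtype_injective
    rw [factors_of_isSimple]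
    rfl
  let e := ofRationalEquiv k C ((regular k C).carrier ⧸ N)
  let e' := (ofRationalEquiv k C T).symm
  have hTB : vertex k C (simpleOf k C T) ∈ injOver B :=
    ⟨simpleOf k C T, rfl, ofRational k C ((regular k C).carrier ⧸ N), hinj.ofRational,
      hover.of_surjective e.toLinearMap e.surjective, e.toLinearMap ∘ₗ T.subtype ∘ₗ e'.toLinearMap,
      e.injective.comp (T.subtype_injective.comp e'.injective)⟩
  have hXB : X ⊆ injOver B := fun x hx => by
    obtain ⟨f⟩ := hpath x hx _ hTX
    exact mem_injOver_of_path hered f hTB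
  intro d hd
  have := finite_span_singleton k C (toRegular k C d)
  have hd' : IsOver B (DualAlg k C ∙ toRegular k C d) :=
    isOver_of_factors_subset (Set.Subset.trans (mem_coalgPart.1 hd) hXB) _ PUnit.{v + 1}
      ratInjective_punit (fun _ _ _ => rfl) 0 rfl
  apply mem_of_ann
  intro f hf
  have h1 := congrArg Subtype.val (hd' f hf ⟨_, Submodule.mem_span_singleton_self _⟩)
  have h2 : act f d = 0 := h1
  rw [← counit_act, h2, map_zero]

end Hereditary

/-! ### Strong connectedness -/

section Strong

variable {k : Type u} {C : Type v} [Field k] [AddCommGroup C] [Module k C] [Coalgebra k C]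

/-- In a semiprime coalgebra, the end of an arrow is joined to its source by a path. -/
lemma IsSemiprime.nonempty_path_of_hom (hC : IsSemiprime k C) {x y : RightGabriel k C}
    (f : x ⟶ y) : Nonempty (Quiver.Path y x) := by
  by_contra hx
  -- The set of vertices reachable from `y` has no outgoing arrow; if `x` were outside it, `f` would
  -- be an arrow entering it.
  exact (hC.isEmpty_hom (X := {z | Nonempty (Quiver.Path y z)})
    (fun z ⟨p⟩ w hw => ⟨fun g => hw ⟨p.cons g⟩⟩) x hx y ⟨Quiver.Path.nil⟩).false f

/-- In an unoriented path, each arrow traversed backwards is replaced by an oriented path. -/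
lemma IsSemiprime.nonempty_path_of_component_eq (hC : IsSemiprime k C) {x y : RightGabriel k C}
    (h : Quiver.WeaklyConnectedComponent.mk x = Quiver.WeaklyConnectedComponent.mk y) :
    Nonempty (Quiver.Path x y) := by
  obtain ⟨p⟩ := (Quiver.WeaklyConnectedComponent.eq x y).1 h
  suffices H : ∀ (a b : Quiver.Symmetrify (RightGabriel k C)), Quiver.Path a b →
      Nonempty (@Quiver.Path (RightGabriel k C) _ a b) from H x y p
  intro a b p
  induction p with
  | nil => exact ⟨Quiver.Path.nil⟩
  | cons _ g ih =>
    obtain ⟨q⟩ := ih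
    rcases g with g | g
    · exact ⟨q.cons g⟩
    · obtain ⟨r⟩ := hC.nonempty_path_of_hom g
      exact ⟨q.comp r⟩

lemma component_eq_of_hom {V : Type*} [Quiver V] {x y : V} (f : x ⟶ y) :
    Quiver.WeaklyConnectedComponent.mk x = Quiver.WeaklyConnectedComponent.mk y :=
  (Quiver.WeaklyConnectedComponent.eq x y).2
    ⟨Quiver.Hom.toPath (V := Quiver.Symmetrify V) (Sum.inl f)⟩

lemma exists_path_component {V : Type*} [Quiver V] {c : Quiver.WeaklyConnectedComponent V}
    {x y : V} (p : Quiver.Path x y) (a : Component c) (ha : a.1 = x) :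
    ∃ b : Component c, b.1 = y ∧ Nonempty (Quiver.Path a b) := by
  induction p with
  | nil => exact ⟨a, ha, ⟨Quiver.Path.nil⟩⟩
  | cons _ g ih =>
    obtain ⟨b, rfl, ⟨q⟩⟩ := ih
    exact ⟨⟨_, (component_eq_of_hom g).symm.trans b.2⟩, rfl, ⟨q.cons g⟩⟩

theorem IsSemiprime.isStronglyConnected (hC : IsSemiprime k C)
    (c : Quiver.WeaklyConnectedComponent (RightGabriel k C)) :
    Quiver.IsStronglyConnected (Component c) := by
  intro a b
  obtain ⟨p⟩ := hC.nonempty_path_of_component_eq (a.2.trans b.2.symm)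
  obtain ⟨b', hb', q⟩ := exists_path_component p a rfl
  rwa [show b' = b from Subtype.ext hb'] at q

variable (k C) in
/-- `C = A ∧ B` for nonzero subcoalgebras `A` and `B` with zero intersection. -/
def IsWedgeOfDisjoint : Prop :=
  ∃ A B : Submodule k C, IsSubcoalgebra k A ∧ IsSubcoalgebra k B ∧ A ≠ ⊥ ∧ B ≠ ⊥ ∧
    A ⊓ B = ⊥ ∧ wedge k A B = ⊤

lemma isOver_toSubmodule {A : Submodule k C} (hA : IsSubcoalgebra k A) :
    IsOver A hA.toSubmodule := fun _ hf a => Subtype.ext (hA.act_eq_zero hf a.2)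

lemma overVertices_nonempty {A : Submodule k C} (hA : IsSubcoalgebra k A) (hne : A ≠ ⊥) :
    (overVertices A).Nonempty := by
  obtain ⟨a, ha, ha0⟩ := (Submodule.ne_bot_iff A).1 hne
  have : Nontrivial hA.toSubmodule :=
    ⟨⟨toRegular k C a, ha⟩, 0, fun h => ha0 (congrArg Subtype.val h)⟩
  obtain ⟨T, hT⟩ := exists_simple_le k C (V := hA.toSubmodule)
  exact ⟨vertex k C (simpleOf k C T), vertex_mem_overVertices_iff.2
    (((isOver_toSubmodule hA).of_injective T.subtype T.subtype_injective).of_surjective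
      (ofRationalEquiv k C T).toLinearMap (ofRationalEquiv k C T).surjective)⟩

/-- The elements of `S` killed by `ann A` form a submodule, so it is `S` or `0`. It contains `ann B
• S` because `ann A * ann B = 0`; if it is `0`, then `ann B` kills `S`. -/
lemma mem_overVertices_or {A B : Submodule k C} (hA : IsSubcoalgebra k A)
    (hw : wedge k A B = ⊤) (x : RightGabriel k C) : x ∈ overVertices A ∨ x ∈ overVertices B := by
  obtain ⟨S, rfl⟩ := Quotient.exists_rep x
  change vertex k C S ∈ _ ∨ vertex k C S ∈ _
  rw [vertex_mem_overVertices_iff, vertex_mem_overVertices_iff]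
  let P : Submodule (DualAlg k C) S.1.carrier :=
    { carrier := {s | ∀ f ∈ ann A, f • s = 0}
      add_mem' := fun ha hb f hf => by rw [smul_add, ha f hf, hb f hf, add_zero]
      zero_mem' := fun f _ => smul_zero f
      smul_mem' := fun r s hs f hf => by
        rw [← mul_smul]; exact hs _ (hA.mul_mem_ann_right hf r) }
  rcases eq_bot_or_eq_top P with h | h
  · right
    intro g hg s
    have : g • s ∈ P := fun f hf => by rw [← mul_smul, mul_eq_zero_of_wedge hw hf hg, zero_smul]
    rw [h] at this
    exact this
  · left
    intro f hf s
    have : s ∈ P := by rw [h]; trivial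
    exact this f hf

lemma disjoint_overVertices {A B : Submodule k C} (hAB : A ⊓ B = ⊥) :
    Disjoint (overVertices A) (overVertices B) := by
  rw [Set.disjoint_left]
  rintro _ ⟨S, rfl, hSA⟩ hSB
  rw [vertex_mem_overVertices_iff] at hSB
  obtain ⟨e, heB, heA⟩ := exists_separating hAB
  have := S.2.1
  obtain ⟨s, hs⟩ := exists_ne (0 : S.1.carrier)
  have h := hSA _ heA s
  rw [sub_smul, hSB e heB, sub_zero, one_smul] at h
  exact hs h

/-- The Gabriel quiver is strongly connected unless `C` is the wedge of nonzero disjoint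
subcoalgebras. -/
lemma isStronglyConnected_iff :
    Quiver.IsStronglyConnected (RightGabriel k C) ↔ ¬ IsWedgeOfDisjoint k C := by
  constructor
  · rintro hsc ⟨A, B, hA, hB, hA0, hB0, hAB, hw⟩
    obtain ⟨x, hx⟩ := overVertices_nonempty hA hA0
    obtain ⟨y, hy⟩ := overVertices_nonempty hB hB0
    obtain ⟨p⟩ := hsc x y
    -- No path starting at a vertex over `A` leaves `overVertices A`: each vertex is over `A` or
    -- `B`, and no arrow goes from the former to the latter.
    suffices h : y ∈ overVertices A from Set.disjoint_left.1 (disjoint_overVertices hAB) h hy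
    clear hy
    induction p with
    | nil => exact hx
    | cons _ g ih =>
      exact (mem_overVertices_or hA hw _).resolve_right fun h =>
        (isEmpty_hom_of_wedge hB hAB hw ih h).false g
  · intro h x y
    by_contra hxy
    let X : Set (RightGabriel k C) := {z | Nonempty (Quiver.Path x z)}
    exact h ⟨coalgPart X, coalgPart Xᶜ, isSubcoalgebra_coalgPart _, isSubcoalgebra_coalgPart _,
      coalgPart_ne_bot ⟨x, ⟨Quiver.Path.nil⟩⟩, coalgPart_ne_bot ⟨y, hxy⟩,
      coalgPart_inf disjoint_compl_right,
      wedge_coalgPart fun z ⟨p⟩ w hw => ⟨fun g => hw ⟨p.cons g⟩⟩⟩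

theorem isPrime_of_isRightHereditary (hered : IsRightHereditary k C)
    (hsc : Quiver.IsStronglyConnected (RightGabriel k C)) : IsPrime k C := by
  intro A B hA _ hw
  have h := coalgPart_prime hered (X := Set.univ) (by rw [coalgPart_univ, top_sup_eq])
    (fun x _ y _ => hsc x y) (B := B) hA (by rw [coalgPart_univ]; exact le_top)
    (by rw [coalgPart_univ, hw])
  rwa [coalgPart_univ, top_le_iff, top_le_iff] at h

end Strong

/-! ### The co-opposite coalgebra -/

section Cop

variable {k : Type u} {C : Type v} [Field k] [AddCommGroup C] [Module k C] [Coalgebra k C]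

lemma isSubcoalgebra_cop_iff {A : Submodule k C} :
    IsSubcoalgebra k (C := Cop C) A ↔ IsSubcoalgebra k A := by
  have hcomm (t : A ⊗[k] A) : TensorProduct.comm k C C
      (TensorProduct.map A.subtype A.subtype t) =
      TensorProduct.map A.subtype A.subtype (TensorProduct.comm k A A t) := by
    rw [TensorProduct.map_comm]
  constructor
  · intro h a ha
    obtain ⟨t, ht⟩ := h a ha
    exact ⟨TensorProduct.comm k A A t, (hcomm t).symm.trans
      ((congrArg (TensorProduct.comm k C C) ht).trans (TensorProduct.comm_comm k _ _ _))⟩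
  · intro h a ha
    obtain ⟨t, ht⟩ := h a ha
    exact ⟨TensorProduct.comm k A A t, (hcomm t).symm.trans
      (congrArg (TensorProduct.comm k C C) ht)⟩

lemma wedge_cop (A B : Submodule k C) : wedge k (C := Cop C) A B = wedge k B A := by
  ext c
  change TensorProduct.map A.mkQ B.mkQ (TensorProduct.comm k C C (Coalgebra.comul c)) = 0 ↔
    TensorProduct.map B.mkQ A.mkQ (Coalgebra.comul c) = 0
  rw [TensorProduct.map_comm]
  exact EmbeddingLike.map_eq_zero_iff

lemma isPrime_cop_iff : IsPrime k (Cop C) ↔ IsPrime k C := by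
  constructor
  · intro h A B hA hB hw
    exact (h B A ((isSubcoalgebra_cop_iff (C := C)).2 hB) ((isSubcoalgebra_cop_iff (C := C)).2 hA)
      ((wedge_cop (C := C) B A).trans hw)).symm
  · intro h A B hA hB hw
    exact (h B A ((isSubcoalgebra_cop_iff (C := C)).1 hB) ((isSubcoalgebra_cop_iff (C := C)).1 hA)
      ((wedge_cop (C := C) A B).symm.trans hw)).symm

lemma isSemiprime_cop (h : IsSemiprime k C) : IsSemiprime k (Cop C) := fun A hA hw =>
  h A ((isSubcoalgebra_cop_iff (C := C)).1 hA) ((wedge_cop (C := C) A A).symm.trans hw)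

lemma isWedgeOfDisjoint_cop_iff : IsWedgeOfDisjoint k (Cop C) ↔ IsWedgeOfDisjoint k C := by
  constructor
  · rintro ⟨A, B, hA, hB, hA0, hB0, hAB, hw⟩
    exact ⟨B, A, (isSubcoalgebra_cop_iff (C := C)).1 hB, (isSubcoalgebra_cop_iff (C := C)).1 hA,
      hB0, hA0, (inf_comm (α := Submodule k C) B A).trans hAB, (wedge_cop (C := C) A B).symm.trans hw⟩
  · rintro ⟨A, B, hA, hB, hA0, hB0, hAB, hw⟩
    exact ⟨B, A, (isSubcoalgebra_cop_iff (C := C)).2 hB, (isSubcoalgebra_cop_iff (C := C)).2 hA,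
      hB0, hA0, (inf_comm B A).trans hAB, (wedge_cop (C := C) B A).trans hw⟩

/-- The criterion involves only subcoalgebras and wedges, and passing to `Cop C` merely exchanges
`A` and `B`. Left and right simple comodules are never compared. -/
lemma isStronglyConnected_left_iff : Quiver.IsStronglyConnected (LeftGabriel k C) ↔
    Quiver.IsStronglyConnected (RightGabriel k C) := by
  rw [isStronglyConnected_iff, isStronglyConnected_iff, isWedgeOfDisjoint_cop_iff]

end Cop

/-! ### A subcoalgebra as a coalgebra -/

section SubCoalgebra

variable {k : Type u} {C : Type v} [Field k] [AddCommGroup C] [Module k C] [Coalgebra k C]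

/-- The restriction of the comultiplication to a subspace. -/
def subComul (A : Submodule k C) : A →ₗ[k] A ⊗[k] A :=
  let p := (LinearMap.exists_leftInverse_of_injective A.subtype
    (LinearMap.ker_eq_bot.2 A.subtype_injective)).choose
  TensorProduct.map p p ∘ₗ Coalgebra.comul ∘ₗ A.subtype

lemma map_subComul {A : Submodule k C} (hA : IsSubcoalgebra k A) :
    TensorProduct.map A.subtype A.subtype ∘ₗ subComul A = Coalgebra.comul ∘ₗ A.subtype := by
  ext a
  obtain ⟨t, ht⟩ := hA a a.2
  have hp := (LinearMap.exists_leftInverse_of_injective A.subtype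
    (LinearMap.ker_eq_bot.2 A.subtype_injective)).choose_spec
  simp only [subComul, LinearMap.comp_apply, Submodule.subtype_apply]
  rw [← ht]
  congr 1
  rw [← LinearMap.comp_apply, ← TensorProduct.map_comp, hp, TensorProduct.map_id,
    LinearMap.id_apply]

/-- The coalgebra structure of a subcoalgebra. -/
abbrev subCoalgebra {A : Submodule k C} (hA : IsSubcoalgebra k A) : Coalgebra k A where
  comul := subComul A
  counit := Coalgebra.counit ∘ₗ A.subtype
  coassoc := by
    -- Over a field, `A ⊗ (A ⊗ A)` embeds in `C ⊗ (C ⊗ C)`, where the identity is coassociativity of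
    -- `C`.
    have hinj : Function.Injective
        (TensorProduct.map A.subtype (TensorProduct.map A.subtype A.subtype)) :=
      TensorProduct.map_injective_of_flat_flat _ _ A.subtype_injective
        (TensorProduct.map_injective_of_flat_flat _ _ A.subtype_injective A.subtype_injective)
    rw [← LinearMap.cancel_left hinj]
    calc
      _ = (TensorProduct.assoc k C C C).toLinearMap ∘ₗ
          (TensorProduct.map (TensorProduct.map A.subtype A.subtype) A.subtype ∘ₗ
            (subComul A).rTensor A) ∘ₗ subComul A := by
        rw [← LinearMap.comp_assoc, TensorProduct.map_map_comp_assoc_eq]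
        rfl
      _ = (TensorProduct.assoc k C C C).toLinearMap ∘ₗ
          ((Coalgebra.comul (R := k) (A := C)).rTensor C ∘ₗ
            TensorProduct.map A.subtype A.subtype) ∘ₗ subComul A := by
        rw [LinearMap.map_comp_rTensor, LinearMap.rTensor_comp_map, map_subComul hA]
      _ = ((Coalgebra.comul (R := k) (A := C)).lTensor C ∘ₗ
            TensorProduct.map A.subtype A.subtype) ∘ₗ subComul A := by
        rw [LinearMap.comp_assoc, LinearMap.comp_assoc, map_subComul hA]
        exact congrArg (· ∘ₗ A.subtype) Coalgebra.coassoc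
      _ = _ := by
        rw [LinearMap.lTensor_comp_map, ← LinearMap.comp_assoc, LinearMap.map_comp_lTensor,
          map_subComul hA]
  rTensor_counit_comp_comul := by
    have hinj : Function.Injective (A.subtype.lTensor k) :=
      Module.Flat.lTensor_preserves_injective_linearMap _ A.subtype_injective
    rw [← LinearMap.cancel_left hinj]
    calc
      _ = ((Coalgebra.counit (R := k) (A := C)).rTensor C ∘ₗ
            TensorProduct.map A.subtype A.subtype) ∘ₗ subComul A := by
        rw [← LinearMap.comp_assoc, LinearMap.lTensor_comp_rTensor, LinearMap.rTensor_comp_map]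
      _ = TensorProduct.mk k k C 1 ∘ₗ A.subtype := by
        rw [LinearMap.comp_assoc, map_subComul hA, ← LinearMap.comp_assoc,
          Coalgebra.rTensor_counit_comp_comul]
      _ = _ := by ext; simp
  lTensor_counit_comp_comul := by
    have hinj : Function.Injective (A.subtype.rTensor k) :=
      Module.Flat.rTensor_preserves_injective_linearMap _ A.subtype_injective
    rw [← LinearMap.cancel_left hinj]
    calc
      _ = ((Coalgebra.counit (R := k) (A := C)).lTensor C ∘ₗ
            TensorProduct.map A.subtype A.subtype) ∘ₗ subComul A := by
        rw [← LinearMap.comp_assoc, LinearMap.rTensor_comp_lTensor, LinearMap.lTensor_comp_map]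
      _ = (TensorProduct.mk k C k).flip 1 ∘ₗ A.subtype := by
        rw [LinearMap.comp_assoc, map_subComul hA, ← LinearMap.comp_assoc,
          Coalgebra.lTensor_counit_comp_comul]
      _ = _ := by ext; simp

/-- A subcoalgebra `D` of `C` is prime as a coalgebra, in terms of the subcoalgebras of `C`. -/
def IsPrimeSub (D : Submodule k C) : Prop :=
  ∀ A B : Submodule k C, IsSubcoalgebra k A → IsSubcoalgebra k B → A ≤ D → B ≤ D →
    D ≤ wedge k A B → D ≤ A ∨ D ≤ B

/-- Subcoalgebras of `D` are subcoalgebras of `C`, and the maps `D / A → C / A` carry a wedge taken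
in `D` into the wedge taken in `C`. -/
lemma isPrime_subCoalgebra {D : Submodule k C} (hD : IsSubcoalgebra k D) (h : IsPrimeSub D) :
    @IsPrime k D _ _ _ (subCoalgebra hD) := by
  let := subCoalgebra hD
  have hcomul (d : D) : Coalgebra.comul (R := k) (d : C) =
      TensorProduct.map D.subtype D.subtype (Coalgebra.comul (R := k) d) :=
    (LinearMap.congr_fun (map_subComul hD) d).symm
  have hsub (A : Submodule k D) (hA : IsSubcoalgebra k A) :
      IsSubcoalgebra k (A.map D.subtype) := by
    rintro _ ⟨a, ha, rfl⟩
    obtain ⟨t, ht⟩ := hA a ha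
    let j : A →ₗ[k] A.map D.subtype := D.subtype.submoduleMap A
    refine ⟨TensorProduct.map j j t, ?_⟩
    rw [Submodule.subtype_apply, hcomul, ← ht, ← LinearMap.comp_apply, ← LinearMap.comp_apply,
      ← TensorProduct.map_comp, ← TensorProduct.map_comp]
    rfl
  have hle (A : Submodule k D) (hA : D ≤ A.map D.subtype) : A = ⊤ := by
    rw [eq_top_iff]
    intro d _
    obtain ⟨a, ha, had⟩ := hA d.2
    rwa [← show a = d from Subtype.ext had]
  intro A B hA hB hw
  refine (h _ _ (hsub A hA) (hsub B hB) (Submodule.map_subtype_le D A)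
    (Submodule.map_subtype_le D B) fun d hd => ?_).imp (hle A) (hle B)
  have h0 : TensorProduct.map A.mkQ B.mkQ (Coalgebra.comul (R := k) (⟨d, hd⟩ : D)) = 0 := by
    have : (⟨d, hd⟩ : D) ∈ wedge k A B := by rw [hw]; trivial
    exact this
  change TensorProduct.map _ _ (Coalgebra.comul (R := k) ((⟨d, hd⟩ : D) : C)) = 0
  rw [hcomul, ← LinearMap.comp_apply, ← TensorProduct.map_comp]
  have hq (A : Submodule k D) : (A.map D.subtype).mkQ ∘ₗ D.subtype =
      A.mapQ (A.map D.subtype) D.subtype (Submodule.le_comap_map _ _) ∘ₗ A.mkQ := rfl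
  rw [hq, hq, TensorProduct.map_comp, LinearMap.comp_apply, h0, map_zero]

variable (k C) in
/-- `C` is the direct sum of a family of nonzero prime subcoalgebras. -/
def HasPrimeDecomposition : Prop :=
  ∃ s : Set (Submodule k C), sSupIndep s ∧ sSup s = ⊤ ∧
    ∀ A ∈ s, IsSubcoalgebra k A ∧ A ≠ ⊥ ∧ IsPrimeSub A

lemma isDirectSumOfPrimes_of_iSupIndep {ι : Type v} (A : ι → Submodule k C)
    (hind : iSupIndep A) (hsup : iSup A = ⊤) (hA : ∀ i, IsSubcoalgebra k (A i))
    (hne : ∀ i, A i ≠ ⊥) (hprime : ∀ i, IsPrimeSub (A i)) : IsDirectSumOfPrimes k C := by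
  classical
  let _ (i : ι) : Coalgebra k (A i) := subCoalgebra (hA i)
  refine ⟨ι, fun i => A i, inferInstance, inferInstance, inferInstance, fun i =>
    ⟨Submodule.nontrivial_iff_ne_bot.2 (hne i), isPrime_subCoalgebra (hA i) (hprime i)⟩, ?_⟩
  let F : (Π₀ i, A i) →ₗ[k] C := DFinsupp.lsum k fun i => (A i).subtype
  have hFs (i : ι) (a : A i) : F (DFinsupp.single i a) = a := DFinsupp.lsum_single _ _ _ _
  have hFc (i : ι) : F ∘ₗ DFinsupp.lsingle i = (A i).subtype := LinearMap.ext fun a => hFs i a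
  have hF : Function.Bijective F := by
    constructor
    · exact hind.dfinsupp_lsum_injective
    · exact LinearMap.range_eq_top.1 ((Submodule.iSup_eq_range_dfinsupp_lsum A).symm.trans hsup)
  let G : (Π₀ i, A i) →ₗc[k] C :=
    { F with
      counit_comp := by
        refine DFinsupp.lhom_ext' fun i => LinearMap.ext fun a => ?_
        change Coalgebra.counit (F (DFinsupp.single i a)) =
          Coalgebra.counit (R := k) (DFinsupp.single i a : Π₀ i, A i)
        rw [hFs, DFinsupp.counit_single]
        rfl
      map_comp_comul := by
        refine DFinsupp.lhom_ext' fun i => LinearMap.ext fun a => ?_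
        change TensorProduct.map F F (Coalgebra.comul (R := k) (DFinsupp.single i a : Π₀ i, A i)) =
          Coalgebra.comul (R := k) (F (DFinsupp.single i a))
        rw [hFs, DFinsupp.comul_single, ← LinearMap.comp_apply, ← TensorProduct.map_comp, hFc]
        exact LinearMap.congr_fun (map_subComul (hA i)) a }
  exact ⟨(CoalgEquiv.ofBijective (f := G) hF).symm⟩

lemma HasPrimeDecomposition.isDirectSumOfPrimes (h : HasPrimeDecomposition k C) :
    IsDirectSumOfPrimes k C := by
  obtain ⟨s, hind, hsup, hs⟩ := h
  exact isDirectSumOfPrimes_of_iSupIndep (fun A : s => A.1) ((sSupIndep_iff _).1 hind)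
    (by rw [← sSup_eq_iSup', hsup]) (fun A => (hs A.1 A.2).1) (fun A => (hs A.1 A.2).2.1)
    (fun A => (hs A.1 A.2).2.2)

end SubCoalgebra

/-! ### The decomposition of a hereditary semiprime coalgebra -/

section Decomposition

variable {k : Type u} {C : Type v} [Field k] [AddCommGroup C] [Module k C] [Coalgebra k C]

lemma torsion_mono {V : Type v} [AddCommGroup V] [Module (DualAlg k C) V]
    {X Y : Set (RightGabriel k C)} (h : X ⊆ Y) : torsion V X ≤ torsion V Y :=
  le_torsion_iff.2 ((factors_torsion X).trans h)

lemma coalgPart_mono {X Y : Set (RightGabriel k C)} (h : X ⊆ Y) : coalgPart X ≤ coalgPart Y :=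
  fun _ hc => mem_coalgPart.2 (torsion_mono h (mem_coalgPart.1 hc))

/-- The vertices of a connected component. -/
def componentSet (c : Quiver.WeaklyConnectedComponent (RightGabriel k C)) :
    Set (RightGabriel k C) :=
  {x | Quiver.WeaklyConnectedComponent.mk x = c}

lemma isEmpty_hom_componentSet (c : Quiver.WeaklyConnectedComponent (RightGabriel k C)) :
    ∀ x ∈ componentSet c, ∀ y ∉ componentSet c, IsEmpty (x ⟶ y) := fun _ hx _ hy =>
  ⟨fun f => hy ((component_eq_of_hom f).symm.trans hx)⟩

lemma componentSet_nonempty (c : Quiver.WeaklyConnectedComponent (RightGabriel k C)) :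
    (componentSet c).Nonempty := Quotient.exists_rep c

/-- The parts of all other components lie in the part of the complement, which meets the given one
in `0`. -/
lemma iSupIndep_coalgPart :
    iSupIndep fun c : Quiver.WeaklyConnectedComponent (RightGabriel k C) =>
      coalgPart (componentSet c) := by
  intro c
  rw [disjoint_iff, eq_bot_iff, ← coalgPart_inf (X := componentSet c) disjoint_compl_right]
  refine inf_le_inf_left _ (iSup₂_le fun c' hc' => coalgPart_mono fun x hx hxc => hc' ?_)
  exact hx.symm.trans hxc

lemma IsSemiprime.iSup_coalgPart (hC : IsSemiprime k C) :
    ⨆ c : Quiver.WeaklyConnectedComponent (RightGabriel k C), coalgPart (componentSet c) = ⊤ := by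
  let N : Submodule (DualAlg k C) (regular k C).carrier :=
    ⨆ c : Quiver.WeaklyConnectedComponent (RightGabriel k C),
      torsion (regular k C).carrier (componentSet c)
  have hN : N = ⊤ := by
    by_contra hN
    have : Nontrivial ((regular k C).carrier ⧸ N) := Submodule.Quotient.nontrivial_iff.2 hN
    obtain ⟨T, hT⟩ := exists_simple_le k C (V := (regular k C).carrier ⧸ N)
    let c := Quiver.WeaklyConnectedComponent.mk (vertex k C (simpleOf k C T))
    -- There may be infinitely many components, so only the splitting at the component `c` of `T` is
    -- used: `e` carries `C` into the part of `c`, hence kills `C / N`, yet it acts as the identity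
    -- on `T`.
    obtain ⟨e, he, he'⟩ := exists_separating
      (coalgPart_inf (X := componentSet c) disjoint_compl_right)
    have h1 : ∀ z : (regular k C).carrier ⧸ N, e • z = 0 := by
      intro z
      obtain ⟨z, rfl⟩ := N.mkQ_surjective z
      have hz : (toRegular k C).symm z ∈
          coalgPart (componentSet c) ⊔ coalgPart (componentSet c)ᶜ := by
        rw [hC.coalgPart_sup (isEmpty_hom_componentSet c)]; trivial
      obtain ⟨a, ha, b, hb, hab⟩ := Submodule.mem_sup.1 hz
      have hab' : toRegular k C a + toRegular k C b = z := hab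
      rw [← hab', ← map_smul, smul_add, smul_eq_zero_of_mem_torsion he (mem_coalgPart.1 hb),
        add_zero]
      have hle : torsion (regular k C).carrier (componentSet c) ≤ N :=
        le_iSup (fun c => torsion (regular k C).carrier (componentSet c)) c
      exact (Submodule.Quotient.mk_eq_zero N).2 (N.smul_mem e (hle (mem_coalgPart.1 ha)))
    have h2 : IsOver (coalgPart (componentSet c)) T := by
      apply isOver_coalgPart
      rw [factors_of_isSimple]
      exact Set.singleton_subset_iff.2 rfl
    have : Nontrivial T := (Submodule.nontrivial_iff (DualAlg k C)).1 hT.toNontrivial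
    obtain ⟨t, ht⟩ := exists_ne (0 : T)
    have h3 := h2 _ he' t
    rw [sub_smul, one_smul, show e • t = 0 from Subtype.ext (h1 t), sub_zero] at h3
    exact ht h3
  rw [eq_top_iff]
  intro x _
  have hx : toRegular k C x ∈ N := by rw [hN]; trivial
  refine Submodule.iSup_induction
    (motive := fun z => (toRegular k C).symm z ∈ ⨆ c, coalgPart (componentSet c)) _ hx
    (fun c z hz => ?_) (Submodule.zero_mem _) fun a b ha hb => ?_
  · exact (le_iSup (fun c => coalgPart (componentSet c)) c) hz
  · rw [map_add]
    exact Submodule.add_mem _ ha hb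

theorem hasPrimeDecomposition (hered : IsRightHereditary k C) (hC : IsSemiprime k C) :
    HasPrimeDecomposition k C := by
  -- The summands are indexed by subspaces of `C` because the components form a type in a larger
  -- universe.
  refine ⟨Set.range fun c : Quiver.WeaklyConnectedComponent (RightGabriel k C) =>
    coalgPart (componentSet c), iSupIndep_coalgPart.sSupIndep_range, hC.iSup_coalgPart, ?_⟩
  rintro _ ⟨c, rfl⟩
  refine ⟨isSubcoalgebra_coalgPart _, coalgPart_ne_bot (componentSet_nonempty c), ?_⟩
  intro A B hA _ hAc _ hw
  exact coalgPart_prime hered (hC.coalgPart_sup (isEmpty_hom_componentSet c))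
    (fun x hx y hy => hC.nonempty_path_of_component_eq (hx.trans hy.symm)) hA hAc hw

lemma isPrimeSub_of_cop {D : Submodule k C} (h : IsPrimeSub (C := Cop C) D) : IsPrimeSub D :=
  fun A B hA hB hAD hBD hw => (h B A ((isSubcoalgebra_cop_iff (C := C)).2 hB)
    ((isSubcoalgebra_cop_iff (C := C)).2 hA) hBD hAD
    (hw.trans_eq (wedge_cop (C := C) B A).symm)).symm

lemma HasPrimeDecomposition.of_cop (h : HasPrimeDecomposition k (Cop C)) :
    HasPrimeDecomposition k C := by
  obtain ⟨s, h1, h2, h3⟩ := h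
  exact ⟨s, h1, h2, fun A hA => ⟨(isSubcoalgebra_cop_iff (C := C)).1 (h3 A hA).1, (h3 A hA).2.1,
    isPrimeSub_of_cop (h3 A hA).2.2⟩⟩

end Decomposition
end CoalgebraPrime

end

/-! ### The theorem -/

theorem mainTheorem3 {k : Type u} [Field k] :
    -- (i)
    (∀ (C : Type v) [AddCommGroup C] [Module k C] [Coalgebra k C],
      CoalgebraPrime.IsSemiprime k C →
        (∀ c : Quiver.WeaklyConnectedComponent (CoalgebraPrime.RightGabriel k C),
          Quiver.IsStronglyConnected (CoalgebraPrime.Component c)) ∧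
        (∀ c : Quiver.WeaklyConnectedComponent (CoalgebraPrime.LeftGabriel k C),
          Quiver.IsStronglyConnected (CoalgebraPrime.Component c))) ∧
    -- (ii)
    (∀ (C : Type v) [AddCommGroup C] [Module k C] [Coalgebra k C],
      CoalgebraPrime.IsRightHereditary k C ∨ CoalgebraPrime.IsLeftHereditary k C →
      Quiver.IsStronglyConnected (CoalgebraPrime.RightGabriel k C) ∨
        Quiver.IsStronglyConnected (CoalgebraPrime.LeftGabriel k C) →
      CoalgebraPrime.IsPrime k C) ∧
    -- the consequence
    (∀ (C : Type v) [AddCommGroup C] [Module k C] [Coalgebra k C],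
      CoalgebraPrime.IsRightHereditary k C ∨ CoalgebraPrime.IsLeftHereditary k C →
      CoalgebraPrime.IsSemiprime k C →
      CoalgebraPrime.IsDirectSumOfPrimes k C) := by
  refine ⟨fun C _ _ _ hC => ⟨hC.isStronglyConnected,
    (CoalgebraPrime.isSemiprime_cop hC).isStronglyConnected⟩, fun C _ _ _ hered hsc => ?_,
    fun C _ _ _ hered hC => CoalgebraPrime.HasPrimeDecomposition.isDirectSumOfPrimes ?_⟩
  -- Strong connectedness passes between the two sides, so it can be used on whichever side heredity
  -- is given.
  · have hr : Quiver.IsStronglyConnected (CoalgebraPrime.RightGabriel k C) :=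
      hsc.elim id CoalgebraPrime.isStronglyConnected_left_iff.1
    rcases hered with hered | hered
    · exact CoalgebraPrime.isPrime_of_isRightHereditary hered hr
    · exact CoalgebraPrime.isPrime_cop_iff.1 (CoalgebraPrime.isPrime_of_isRightHereditary hered
        (CoalgebraPrime.isStronglyConnected_left_iff.2 hr))
  · rcases hered with hered | hered
    · exact CoalgebraPrime.hasPrimeDecomposition hered hC
    · exact (CoalgebraPrime.hasPrimeDecomposition hered
        (CoalgebraPrime.isSemiprime_cop hC)).of_cop
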